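/- Let $n,\delta\ge 0$ be integers. Consider the collection of all closed subvarieties $Z\subseteq\mathbb{P}^n_k$ of degree at most $\delta$, where $k$ runs over all algebraically closed fields; here a closed subvariety is an integral closed subscheme, and its degree is $d!$ times the leading coefficient of its Hilbert polynomial, where $d=\dim Z$ is the degree of that polynomial. This collection is bounded: there exist a scheme $S$ of finite type over $\mathbb{Z}$ and a closed subscheme $X\subseteq\mathbb{P}^n_S$ such that for every algebraically closed field $k$ and every closed subvariety $Z\subseteq\mathbb{P}^n_k$ of degree at most $\delta$ there is a point $s\in S(k)$ for which $Z$ equals the fibre $X_s=X\times_S\operatorname{Spec}k$ as a closed subscheme of $\mathbb{P}^n_k$. -/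

import Mathlib

open CategoryTheory CategoryTheory.Limits AlgebraicGeometry

universe u

attribute [local instance] MvPolynomial.gradedAlgebra

noncomputable section

/-- Projective `n`-space over `ℤ`, i.e. `Proj ℤ[x₀, …, xₙ]`, as a scheme in the universe `u`. -/
abbrev ProjZ (n : ℕ) : Scheme.{u} :=
  Proj (MvPolynomial.homogeneousSubmodule (Fin (n + 1)) (ULift.{u} ℤ))

/-- Projective `n`-space `ℙⁿ_S = S × ℙⁿ_ℤ` over a scheme `S`. -/
def ProjSpace (n : ℕ) (S : Scheme.{u}) : Scheme.{u} :=
  pullback (terminal.from S) (terminal.from (ProjZ.{u} n))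

namespace ProjSpace

variable (n : ℕ)

/-- The structure morphism `ℙⁿ_S ⟶ S`. -/
def toBase (S : Scheme.{u}) : ProjSpace n S ⟶ S := pullback.fst _ _

/-- The projection `ℙⁿ_S ⟶ ℙⁿ_ℤ`. -/
def toProjZ (S : Scheme.{u}) : ProjSpace n S ⟶ ProjZ.{u} n := pullback.snd _ _

/-- The morphism `ℙⁿ_T ⟶ ℙⁿ_S` induced by `s : T ⟶ S`. -/
def map {T S : Scheme.{u}} (s : T ⟶ S) : ProjSpace n T ⟶ ProjSpace n S :=
  pullback.lift (toBase n T ≫ s) (toProjZ n T) (terminal.hom_ext _ _)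

variable {n}

/-- The standard open set `x_i ≠ 0` of `ℙⁿ_ℤ`. -/
def chart (i : Fin (n + 1)) : (ProjZ.{u} n).Opens :=
  Proj.basicOpen _ (MvPolynomial.X i)

theorem X_mem_homogeneousSubmodule (R : Type u) [CommRing R] (i : Fin (n + 1)) :
    MvPolynomial.X i ∈ MvPolynomial.homogeneousSubmodule (Fin (n + 1)) R 1 :=
  MvPolynomial.isHomogeneous_X _ i

/-- The function `x_j / x_i` on the standard open set `x_i ≠ 0` of `ℙⁿ_ℤ`. -/
def ratio (i j : Fin (n + 1)) : Γ(ProjZ.{u} n, chart i) :=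
  (Proj.awayToSection (MvPolynomial.homogeneousSubmodule (Fin (n + 1)) (ULift.{u} ℤ))
    (MvPolynomial.X i)).hom
    (HomogeneousLocalization.Away.mk _ (d := 1) (X_mem_homogeneousSubmodule _ i) 1
      (MvPolynomial.X j) ((one_smul ℕ 1).symm ▸ X_mem_homogeneousSubmodule _ j))

variable {k : Type u} [Field k] {Z : Scheme.{u}} (f : Z ⟶ ProjSpace n (Spec (.of k)))

/-- The open subscheme `x_i ≠ 0` of a scheme `Z` over `ℙⁿ_k`. -/
def chartOn (i : Fin (n + 1)) : Z.Opens :=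
  (f ≫ toProjZ n _) ⁻¹ᵁ chart i

/-- The inclusion of constants `k → Γ(Z, x_i ≠ 0)`, for a scheme `Z` over `ℙⁿ_k`. -/
def constants (i : Fin (n + 1)) : k →+* Γ(Z, chartOn f i) :=
  ((Scheme.ΓSpecIso (.of k)).inv ≫ (f ≫ toBase n _).appTop ≫
    Z.presheaf.map (homOfLE le_top : chartOn f i ⟶ ⊤).op).hom

/-- Restriction of a polynomial to the chart `x_i ≠ 0` of a scheme `Z` over `ℙⁿ_k`: it sends
`F(x₀, …, xₙ)` to the function `F(x₀ / x_i, …, xₙ / x_i)` on `Z ∩ {x_i ≠ 0}`. -/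
def dehomogenize (i : Fin (n + 1)) :
    MvPolynomial (Fin (n + 1)) k →+* Γ(Z, chartOn f i) :=
  MvPolynomial.eval₂Hom (constants f i)
    (fun j => ((f ≫ toProjZ n _).app (chart i)).hom (ratio i j))

/-- The homogeneous ideal of a subscheme `Z` of `ℙⁿ_k`: the ideal of `k[x₀, …, xₙ]` generated by
the homogeneous polynomials that vanish on `Z`, that is, whose restriction to `Z ∩ {x_i ≠ 0}`
is zero for every `i`. -/
def vanishingIdeal :
    HomogeneousIdeal (MvPolynomial.homogeneousSubmodule (Fin (n + 1)) k) :=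
  (⨅ i, RingHom.ker (dehomogenize f i)).homogeneousCore _


end ProjSpace

section HilbertPolynomial

variable {n : ℕ} {k : Type u} [Field k]

/-- The Hilbert function of a homogeneous ideal `I` of `S = k[x₀, …, xₙ]`: the dimension over `k`
of the degree `m` part `S_m / I_m` of `S / I`. -/
def hilbertFunction (I : HomogeneousIdeal (MvPolynomial.homogeneousSubmodule (Fin (n + 1)) k))
    (m : ℕ) : ℕ :=
  Module.finrank k (MvPolynomial.homogeneousSubmodule (Fin (n + 1)) k m ⧸
    (I.toIdeal.restrictScalars k).comap
      (MvPolynomial.homogeneousSubmodule (Fin (n + 1)) k m).subtype)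

open MvPolynomial DirectSum in
theorem hilbertFunction_succ
    (I J K : HomogeneousIdeal (homogeneousSubmodule (Fin (n + 1)) k)) (i : Fin (n + 1))
    (hJ : ∀ p, p ∈ J.toIdeal ↔ X i * p ∈ I.toIdeal)
    (hK : K.toIdeal = I.toIdeal ⊔ Ideal.span {X i}) (m : ℕ) :
    hilbertFunction I (m + 1) = hilbertFunction J m + hilbertFunction K (m + 1) := by
  let 𝒜 := homogeneousSubmodule (Fin (n + 1)) k
  let M (L : HomogeneousIdeal 𝒜) (m : ℕ) : Submodule k (𝒜 m) :=
    (L.toIdeal.restrictScalars k).comap (𝒜 m).subtype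
  have hX : (X i : MvPolynomial (Fin (n + 1)) k) ∈ 𝒜 1 := isHomogeneous_X _ i
  have hmul : ∀ p ∈ 𝒜 m, LinearMap.mulLeft k (X i) p ∈ 𝒜 (m + 1) := fun p hp => by
    have h := SetLike.mul_mem_graded hX hp
    rw [add_comm 1 m] at h
    exact h
  let μ : 𝒜 m →ₗ[k] 𝒜 (m + 1) := (LinearMap.mulLeft k (X i)).restrict hmul
  have hIK : M I (m + 1) ≤ M K (m + 1) := fun p hp => by
    change (p : MvPolynomial (Fin (n + 1)) k) ∈ K.toIdeal
    rw [hK]; exact Ideal.mem_sup_left hp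
  have hJI : M J m = (M I (m + 1)).comap μ := by
    ext p; exact hJ p
  let φ : (𝒜 m ⧸ M J m) →ₗ[k] (𝒜 (m + 1) ⧸ M I (m + 1)) := (M J m).mapQ (M I (m + 1)) μ hJI.le
  let ψ : (𝒜 (m + 1) ⧸ M I (m + 1)) →ₗ[k] (𝒜 (m + 1) ⧸ M K (m + 1)) :=
    (M I (m + 1)).mapQ (M K (m + 1)) LinearMap.id hIK
  have : Module.Finite k (𝒜 (m + 1)) :=
    Module.Finite.iff_fg.mpr (homogeneousSubmodule_fg _ _ _)
  have hφ : Function.Injective φ := by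
    rw [← LinearMap.ker_eq_bot, Submodule.ker_mapQ, ← hJI, ← le_bot_iff, Submodule.map_le_iff_le_comap,
      Submodule.comap_bot, Submodule.ker_mkQ]
  have hψ : Function.Surjective ψ := by
    intro y
    obtain ⟨y, rfl⟩ := Submodule.Quotient.mk_surjective _ y
    exact ⟨Submodule.Quotient.mk y, rfl⟩
  have hex : LinearMap.ker ψ = LinearMap.range φ := by
    apply le_antisymm
    · intro y hy
      obtain ⟨y, rfl⟩ := Submodule.Quotient.mk_surjective _ y
      have hy' : (y : MvPolynomial (Fin (n + 1)) k) ∈ K.toIdeal :=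
        (Submodule.Quotient.mk_eq_zero (M K (m + 1))).mp hy
      rw [hK, Submodule.mem_sup] at hy'
      obtain ⟨a, ha, b, hb, hab⟩ := hy'
      obtain ⟨q, rfl⟩ := Ideal.mem_span_singleton'.mp hb
      refine ⟨Submodule.Quotient.mk (decompose 𝒜 q m), ?_⟩
      refine (Submodule.Quotient.eq (M I (m + 1))).mpr ?_
      change X i * (decompose 𝒜 q m : MvPolynomial (Fin (n + 1)) k) -
        (y : MvPolynomial (Fin (n + 1)) k) ∈ I.toIdeal
      have h1 := coe_decompose_mul_add_of_left_mem (𝒜 := 𝒜) (j := m) (b := q) hX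
      have h2 : ((decompose 𝒜 (y : MvPolynomial (Fin (n + 1)) k) (1 + m) :
          𝒜 (1 + m)) : MvPolynomial (Fin (n + 1)) k) = y :=
        decompose_of_mem_same 𝒜 (by rw [add_comm 1 m]; exact y.2)
      rw [← h1, ← h2, ← hab, decompose_add, DirectSum.add_apply, mul_comm q]
      have h3 := I.toIdeal.neg_mem (I.isHomogeneous (1 + m) ha)
      convert h3 using 1
      rw [Submodule.coe_add]
      ring
    · rintro _ ⟨y, rfl⟩
      obtain ⟨y, rfl⟩ := Submodule.Quotient.mk_surjective _ y
      refine (Submodule.Quotient.mk_eq_zero (M K (m + 1))).mpr ?_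
      change X i * (y : MvPolynomial (Fin (n + 1)) k) ∈ K.toIdeal
      rw [hK]
      exact Ideal.mem_sup_right (Ideal.mul_mem_right _ _ (Ideal.mem_span_singleton_self _))
  have h := LinearMap.finrank_range_add_finrank_ker ψ
  rw [hex, LinearMap.finrank_range_of_inj hφ, LinearMap.range_eq_top.mpr hψ, finrank_top,
    add_comm] at h
  exact h.symm

open MvPolynomial DirectSum in
theorem hilbertSeries_rational
    (I : HomogeneousIdeal (homogeneousSubmodule (Fin (n + 1)) k)) :
    ∃ (p : Polynomial ℚ) (d : ℕ),
      PowerSeries.mk (fun m => (hilbertFunction I m : ℚ)) * (1 - PowerSeries.X) ^ d =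
        (p : PowerSeries ℚ) := by
  induction hI : I.toIdeal using WellFoundedGT.induction generalizing I with
  | ind I' ih =>
  subst hI
  by_cases hall : ∀ i, X i ∈ I.toIdeal
  · refine ⟨Polynomial.C (hilbertFunction I 0 : ℚ), 0, ?_⟩
    ext m
    rw [pow_zero, mul_one, Polynomial.coe_C, PowerSeries.coeff_mk, PowerSeries.coeff_C]
    split_ifs with hm
    · rw [hm]
    · have : Subsingleton (homogeneousSubmodule (Fin (n + 1)) k m ⧸
          (I.toIdeal.restrictScalars k).comap
            (homogeneousSubmodule (Fin (n + 1)) k m).subtype) := by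
        rw [Submodule.Quotient.subsingleton_iff, eq_top_iff]
        rintro ⟨y, hy⟩ -
        have hspan : Ideal.span (X '' (Set.univ : Set (Fin (n + 1)))) ≤ I.toIdeal :=
          Ideal.span_le.mpr (by rintro _ ⟨i, -, rfl⟩; exact hall i)
        refine hspan (mem_ideal_span_X_image.mpr fun c hc => ?_)
        by_contra! hzero
        have h := hy (mem_support_iff.mp hc)
        have hc0 : c = 0 := Finsupp.ext fun i => hzero i (Set.mem_univ i)
        rw [hc0, map_zero] at h
        exact hm h.symm
      rw [hilbertFunction, Module.finrank_zero_of_subsingleton, Nat.cast_zero]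
  · push Not at hall
    obtain ⟨i, hi⟩ := hall
    have hX : (X i : MvPolynomial (Fin (n + 1)) k) ∈ homogeneousSubmodule (Fin (n + 1)) k 1 :=
      isHomogeneous_X _ i
    let J : HomogeneousIdeal (homogeneousSubmodule (Fin (n + 1)) k) :=
      { toSubmodule := Submodule.comap (LinearMap.mulLeft (MvPolynomial (Fin (n + 1)) k) (X i)) I.toIdeal
        is_homogeneous' := fun m r hr => by
          have h := I.isHomogeneous (1 + m) hr
          rw [LinearMap.mulLeft_apply, coe_decompose_mul_add_of_left_mem _ hX] at h
          exact h }
    let K : HomogeneousIdeal (homogeneousSubmodule (Fin (n + 1)) k) :=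
      I ⊔ ⟨Ideal.span {X i}, Ideal.homogeneous_span _ _ (by rintro x rfl; exact ⟨1, hX⟩)⟩
    have hIK : I.toIdeal < K.toIdeal := by
      rw [HomogeneousIdeal.toIdeal_sup]
      refine lt_of_le_of_ne le_sup_left fun h => hi ?_
      rw [h]
      exact Ideal.mem_sup_right (Ideal.mem_span_singleton_self _)
    have hIJ : I.toIdeal ≤ J.toIdeal := fun p hp => Ideal.mul_mem_left _ _ hp
    have key : PowerSeries.mk (fun m => (hilbertFunction I m : ℚ)) =
        PowerSeries.C ((hilbertFunction I 0 : ℚ) - hilbertFunction K 0) +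
        PowerSeries.X * PowerSeries.mk (fun m => (hilbertFunction J m : ℚ)) +
        PowerSeries.mk (fun m => (hilbertFunction K m : ℚ)) := by
      ext m
      cases m with
      | zero => simp
      | succ m =>
        have := hilbertFunction_succ I J K i (fun p => Iff.rfl)
          (HomogeneousIdeal.toIdeal_sup _ _) m
        simp only [map_add, PowerSeries.coeff_mk, PowerSeries.coeff_succ_X_mul,
          PowerSeries.coeff_C, this]
        simp
    obtain ⟨q, e, hq⟩ := ih _ hIK K rfl
    rcases hIJ.lt_or_eq with hlt | heq
    · obtain ⟨p, d, hp⟩ := ih _ hlt J rfl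
      refine ⟨Polynomial.C ((hilbertFunction I 0 : ℚ) - hilbertFunction K 0) *
        (1 - Polynomial.X) ^ (d + e) + Polynomial.X * p * (1 - Polynomial.X) ^ e +
        q * (1 - Polynomial.X) ^ d, d + e, ?_⟩
      rw [key]
      simp only [Polynomial.coe_add, Polynomial.coe_mul, Polynomial.coe_pow, Polynomial.coe_sub,
        Polynomial.coe_one, Polynomial.coe_X, Polynomial.coe_C]
      rw [← hp, ← hq]
      ring
    · have hIJ' : J = I := HomogeneousIdeal.ext heq.symm
      rw [hIJ'] at key
      refine ⟨Polynomial.C ((hilbertFunction I 0 : ℚ) - hilbertFunction K 0) *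
        (1 - Polynomial.X) ^ e + q, e + 1, ?_⟩
      simp only [Polynomial.coe_add, Polynomial.coe_mul, Polynomial.coe_pow, Polynomial.coe_sub,
        Polynomial.coe_one, Polynomial.coe_X, Polynomial.coe_C]
      rw [← hq]
      linear_combination (1 - PowerSeries.X) ^ e * key

open Filter in
/-- The Hilbert function of a homogeneous ideal agrees with a polynomial in large degrees. -/
theorem exists_hilbertPolynomial
    (I : HomogeneousIdeal (MvPolynomial.homogeneousSubmodule (Fin (n + 1)) k)) :
    ∃ P : Polynomial ℚ, ∀ᶠ m : ℕ in atTop, (hilbertFunction I m : ℚ) = P.eval (m : ℚ) := by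
  obtain ⟨p, d, h⟩ := hilbertSeries_rational I
  refine ⟨p.hilbertPoly d, ?_⟩
  filter_upwards [eventually_gt_atTop p.natDegree] with m hm
  rw [← Polynomial.coeff_mul_invOneSubPow_eq_hilbertPoly_eval d hm, ← h, mul_assoc,
    ← PowerSeries.invOneSubPow_inv_eq_one_sub_pow, Units.inv_val]
  simp

/-- The Hilbert polynomial of a homogeneous ideal `I` of `k[x₀, …, xₙ]`: the unique polynomial `P`
with `P(m) = dim (S_m / I_m)` for all large `m`. -/
def hilbertPolynomial
    (I : HomogeneousIdeal (MvPolynomial.homogeneousSubmodule (Fin (n + 1)) k)) : Polynomial ℚ :=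
  (exists_hilbertPolynomial I).choose

open Filter in
theorem hilbertPolynomial_eq_iff
    (I : HomogeneousIdeal (MvPolynomial.homogeneousSubmodule (Fin (n + 1)) k)) (P : Polynomial ℚ) :
    hilbertPolynomial I = P ↔
      ∀ᶠ m : ℕ in atTop, (hilbertFunction I m : ℚ) = P.eval (m : ℚ) := by
  have hI := (exists_hilbertPolynomial I).choose_spec
  refine ⟨fun h => h ▸ hI, fun hP => ?_⟩
  obtain ⟨N, hN⟩ := eventually_atTop.mp (hI.and hP)
  refine Polynomial.eq_of_infinite_eval_eq _ _
    (((Set.Ici_infinite N).image Nat.cast_injective.injOn).mono ?_)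
  rintro _ ⟨m, hm, rfl⟩
  exact (hN m hm).1.symm.trans (hN m hm).2

end HilbertPolynomial

/-- The degree of a closed subscheme `Z` of `ℙⁿ_k`, given by a closed immersion `f`: it is `d!`
times the leading coefficient of the Hilbert polynomial of `Z`, where `d` is the degree of that
polynomial (which is the dimension of `Z`). -/
def projDegree {n : ℕ} {k : Type u} [Field k] {Z : Scheme.{u}}
    (f : Z ⟶ ProjSpace n (Spec (.of k))) : ℚ :=
  (hilbertPolynomial (ProjSpace.vanishingIdeal f)).natDegree.factorial *
    (hilbertPolynomial (ProjSpace.vanishingIdeal f)).leadingCoeff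

/-- A collection of closed subschemes `Z ⊆ ℙⁿ_k`, where `k` runs over algebraically closed fields,
is given by a predicate `C` on closed immersions `Z ⟶ ℙⁿ_k`. It is bounded if there are a scheme
`S` of finite type over `ℤ` and a closed subscheme `X ⊆ ℙⁿ_S` such that each member `Z ⊆ ℙⁿ_k` is
the fibre of `X ⊆ ℙⁿ_S` at some geometric point `s : Spec k ⟶ S`. -/
def IsBoundedCollection (n : ℕ)
    (C : ∀ (k : Type u) [Field k] [IsAlgClosed k] (Z : Scheme.{u})
      (f : Z ⟶ ProjSpace n (Spec (.of k))) [IsClosedImmersion f], Prop) : Prop :=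
  ∃ (S : Scheme.{u}) (p : S ⟶ Spec (.of (ULift.{u} ℤ))) (X : Scheme.{u}) (j : X ⟶ ProjSpace n S),
    LocallyOfFiniteType p ∧ QuasiCompact p ∧ IsClosedImmersion j ∧
    ∀ (k : Type u) [Field k] [IsAlgClosed k] (Z : Scheme.{u})
      (f : Z ⟶ ProjSpace n (Spec (.of k))) [IsClosedImmersion f], C k Z f →
      ∃ (s : Spec (.of k) ⟶ S) (g : Z ⟶ X), IsPullback g f j (ProjSpace.map n s)

end

/-!
A closed subvariety `Z` of `ℙⁿ_k` is determined by its homogeneous ideal `P`, a prime ideal of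
`k[x₀, …, xₙ]` which does not contain all variables. The heart of the matter is that `P` is
generated in degrees `≤ D`, where `D` depends only on `n` and `δ`
(`exists_bound_eq_span_totalDegree_le`). Granting this, `Z` is cut out by a family of forms of
degrees `≤ D`, one for every monomial `t` of degree `≤ D` and of the same degree as `t`. The base
`S` is an affine space over `ℤ` whose coordinates hold the coefficients of such a family, and `X` is
the closed subscheme of `ℙⁿ_S` defined by the universal forms (`ProjSpace.exists_idealSheafData`).

The degree bound has two ingredients.

* *Linear projections.* Let `R = k[x₀, …, xₙ] / P`. As `k` is perfect, some of the variables, say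
  those indexed by a set `I`, form a separating transcendence basis of the fraction field `L` of `R`
  over `k`; put `K = k(x_I)`. The kernel of `K[x] → L` is generated by the minimal polynomials over
  `K` of the linear combinations `∑ λⱼ xⱼ` with `λ` in `k`, evaluated at the linear forms `∑ λⱼ Xⱼ`
  (`mem_projectionIdeal`): these equations define an unramified, hence reduced `K`-algebra, and for
  generic `λ` they determine the point. Geometrically these are the equations of the images of `Z`
  under linear projections onto hypersurfaces. Made primitive over `k[x_I]`, each of them is
  homogeneous of degree at most the degree of `Z`, because the Hilbert function of `Z` bounds that
  of the hypersurface from above (`multichoose_le_hilbertFunction_add`,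
  `le_factorial_mul_leadingCoeff_hilbertPolynomial`). Here it matters that the Hilbert polynomial of
  `Z` has degree `#I - 1`, which an upper bound by counting standard monomials shows
  (`exists_hilbertFunction_le`). Hence for each `f` in `P` there is `g ≠ 0` in `k[x_I]` such that
  `g f` lies in the ideal generated by the elements of `P` of degree at most `δ`
  (`exists_mul_mem_span_totalDegree_le`).

* *Uniform saturation.* As `P` is prime, it is thus the contraction of the extension to
  `k(x_I)[xⱼ, j ∉ I]` of an ideal generated in degrees `≤ δ`. In a family of ideals over a
  Noetherian ring, such contractions are generated in bounded degree (`exists_degree_bound_contraction`). Over a dense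
  open subset of the parameter space this follows from Gröbner bases: a Gröbner basis over the
  generic point stays one under specialization as long as its leading coefficients do not vanish
  (`MonomialOrder.exists_groebner`). It applies once over `A[x_I]`, to replace the set of all `g` by
  the powers of a single one, and once for an elimination order, to saturate with respect to that
  one. Noetherian induction does the rest.

On the side of schemes, dehomogenization (`ProjSpace.standardHom`) presents the functions on the
standard charts of `ℙⁿ_R`. A reduced closed subscheme `Z` is cut out on each chart by the
dehomogenized elements of its homogeneous ideal (`ProjSpace.ker_app_eq_map_vanishingIdeal`), and this
identifies the ideal sheaf of `Z` with the pullback of that of `X` (`ProjSpace.comap_eq_ker`).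
-/


/-! ### Gröbner bases over domains and specialization -/

section Groebner

open MvPolynomial

open scoped MonomialOrder

variable {σ : Type*} (m : MonomialOrder σ)

theorem MonomialOrder.degree_map_of_leadingCoeff_ne_zero {R C : Type*} [CommRing R] [CommRing C]
    (φ : R →+* C) {b : MvPolynomial σ R} (hb : φ (m.leadingCoeff b) ≠ 0) :
    m.degree (MvPolynomial.map φ b) = m.degree b := by
  apply m.toSyn.injective
  apply le_antisymm
  · rw [m.degree_le_iff]
    intro c hc
    exact m.le_degree (support_map_subset _ _ hc)
  · apply m.le_degree
    rw [mem_support_iff, coeff_map]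
    exact hb

theorem MonomialOrder.leadingCoeff_map_of_ne_zero {R C : Type*} [CommRing R] [CommRing C]
    (φ : R →+* C) {b : MvPolynomial σ R} (hb : φ (m.leadingCoeff b) ≠ 0) :
    m.leadingCoeff (MvPolynomial.map φ b) = φ (m.leadingCoeff b) := by
  rw [MonomialOrder.leadingCoeff, m.degree_map_of_leadingCoeff_ne_zero φ hb, coeff_map]
  rfl

/-- A Gröbner basis with invertible leading coefficients stays one after any change of the ring of
coefficients: the standard monomials form a basis of the quotient, and bases are stable under
base change. -/
theorem MonomialOrder.exists_degree_le_of_mem_map {R B ι : Type*} [CommRing R] [CommRing B]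
    (φ : R →+* B) (J : Ideal (MvPolynomial σ R)) (b : ι → MvPolynomial σ R)
    (hu : ∀ i, IsUnit (m.leadingCoeff (b i))) (hbJ : ∀ i, b i ∈ J)
    (hJ : ∀ f ∈ J, f ≠ 0 → ∃ i, m.degree (b i) ≤ m.degree f)
    {f : MvPolynomial σ B} (hf : f ∈ J.map (MvPolynomial.map φ)) (hf0 : f ≠ 0) :
    ∃ i, m.degree (b i) ≤ m.degree f := by
  classical
  have hB : Nontrivial B := by
    by_contra h
    rw [not_nontrivial_iff_subsingleton] at h
    exact hf0 (Subsingleton.elim _ _)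
  have hstd0 : ∀ f ∈ J, (∀ c ∈ f.support, ∀ i, ¬ m.degree (b i) ≤ c) → f = 0 := by
    intro f hf hs
    by_contra h0
    obtain ⟨i, hi⟩ := hJ f hf h0
    exact hs _ (m.degree_mem_support h0) i hi
  -- `π a` is the normal form of the monomial `a`
  have hnf : ∀ a : σ →₀ ℕ, ∃ r : MvPolynomial σ R, monomial a 1 - r ∈ J ∧
      ∀ c ∈ r.support, ∀ i, ¬ m.degree (b i) ≤ c := by
    intro a
    obtain ⟨g, r, h1, -, h3⟩ := m.div hu (monomial a (1 : R))
    refine ⟨r, ?_, h3⟩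
    rw [h1, add_sub_cancel_right, Finsupp.linearCombination_apply]
    exact J.sum_mem fun i _ => J.mul_mem_left _ (hbJ i)
  choose π hπJ hπ using hnf
  let N : MvPolynomial σ R →ₗ[R] MvPolynomial σ R := (basisMonomials σ R).constr R π
  let N' : MvPolynomial σ B →ₗ[B] MvPolynomial σ B :=
    (basisMonomials σ B).constr B fun a => MvPolynomial.map φ (π a)
  have hN (a : σ →₀ ℕ) (c : R) : N (monomial a c) = c • π a := by
    have : monomial a c = c • monomial a (1 : R) := by simp [smul_monomial]
    rw [this, map_smul]
    simpa using congrArg (c • ·) ((basisMonomials σ R).constr_basis R π a)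
  have hN' (a : σ →₀ ℕ) (c : B) : N' (monomial a c) = c • MvPolynomial.map φ (π a) := by
    have : monomial a c = c • monomial a (1 : B) := by simp [smul_monomial]
    rw [this, map_smul]
    simpa using congrArg (c • ·)
      ((basisMonomials σ B).constr_basis B (fun a => MvPolynomial.map φ (π a)) a)
  have hNsub (f : MvPolynomial σ R) : f - N f ∈ J := by
    induction f using MvPolynomial.induction_on' with
    | monomial a c =>
      have : monomial a c = c • monomial a (1 : R) := by simp [smul_monomial]
      rw [hN, this, ← smul_sub]
      exact Submodule.smul_of_tower_mem J c (hπJ a)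
    | add p q hp hq =>
      rw [map_add, add_sub_add_comm]
      exact J.add_mem hp hq
  have hNstd (f : MvPolynomial σ R) : ∀ c ∈ (N f).support, ∀ i, ¬ m.degree (b i) ≤ c := by
    induction f using MvPolynomial.induction_on' with
    | monomial a c =>
      rw [hN]
      exact fun d hd => hπ a d (support_smul hd)
    | add p q hp hq =>
      rw [map_add]
      intro d hd
      rcases Finset.mem_union.mp (support_add hd) with h | h
      exacts [hp d h, hq d h]
  have hNJ (f : MvPolynomial σ R) (hf : f ∈ J) : N f = 0 := by
    refine hstd0 _ ?_ (hNstd f)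
    have := J.sub_mem hf (hNsub f)
    rwa [sub_sub_cancel] at this
  have hNN' (f : MvPolynomial σ R) : N' (MvPolynomial.map φ f) = MvPolynomial.map φ (N f) := by
    induction f using MvPolynomial.induction_on' with
    | monomial a c => simp [hN, hN', smul_eq_C_mul]
    | add p q hp hq => simp only [map_add, hp, hq]
  have hN'J (f : MvPolynomial σ B) (hf : f ∈ J.map (MvPolynomial.map φ)) : N' f = 0 := by
    suffices ∀ g, N' (g * f) = 0 by simpa using this 1
    rw [Ideal.map] at hf
    induction hf using Submodule.span_induction with
    | zero => simp
    | add p q _ _ hp hq => intro g; rw [mul_add, map_add, hp, hq, add_zero]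
    | smul c p _ hp => intro g; rw [smul_eq_mul, ← mul_assoc, hp]
    | mem p hp =>
      obtain ⟨f, hf, rfl⟩ := hp
      intro g
      induction g using MvPolynomial.induction_on' with
      | add p q hp hq => rw [add_mul, map_add, hp, hq, add_zero]
      | monomial a c =>
        have : monomial a c * MvPolynomial.map φ f =
            c • MvPolynomial.map φ (monomial a 1 * f) := by
          rw [map_mul, map_monomial, map_one, smul_eq_C_mul, ← mul_assoc, C_mul_monomial, mul_one]
        rw [this, map_smul, hNN', hNJ _ (J.mul_mem_left _ hf), map_zero, smul_zero]
  have hstd (f : MvPolynomial σ B) (hs : ∀ c ∈ f.support, ∀ i, ¬ m.degree (b i) ≤ c) :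
      N' f = f := by
    rw [f.as_sum, map_sum]
    refine Finset.sum_congr rfl fun a ha => ?_
    have : monomial a (1 : R) - π a = 0 := by
      refine hstd0 _ (hπJ a) fun c hc i => ?_
      rcases Finset.mem_union.mp (support_sub σ _ _ hc) with h | h
      · rw [Finset.mem_singleton.mp (support_monomial_subset h)]
        exact hs a ha i
      · exact hπ a c h i
    rw [hN', ← sub_eq_zero.mp this]
    simp [smul_monomial]
  have hub (i : ι) : φ (m.leadingCoeff (b i)) ≠ 0 := ((hu i).map φ).ne_zero
  have hub' (i : ι) : IsUnit (m.leadingCoeff (MvPolynomial.map φ (b i))) := by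
    rw [m.leadingCoeff_map_of_ne_zero φ (hub i)]
    exact (hu i).map φ
  obtain ⟨q, r, h1, h2, h3⟩ := m.div hub' f
  have hr : r = 0 := by
    rw [← hstd r fun c hc i => by
      rw [← m.degree_map_of_leadingCoeff_ne_zero φ (hub i)]; exact h3 c hc i]
    apply hN'J
    rw [← sub_eq_of_eq_add' h1, Finsupp.linearCombination_apply]
    refine Ideal.sub_mem _ hf (Ideal.sum_mem _ fun i _ => Ideal.mul_mem_left _ _
      (Ideal.mem_map_of_mem _ (hbJ i)))
  rw [hr, add_zero, Finsupp.linearCombination_apply] at h1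
  have hc : coeff (m.degree f) f ≠ 0 := m.coeff_degree_ne_zero_iff.mpr hf0
  nth_rw 2 [h1] at hc
  rw [Finsupp.sum, coeff_sum] at hc
  obtain ⟨i, -, hi⟩ := Finset.exists_ne_zero_of_sum_ne_zero hc
  refine ⟨i, ?_⟩
  rw [smul_eq_mul, mul_comm] at hi
  have hdeg : m.degree (MvPolynomial.map φ (b i) * q i) = m.degree f :=
    m.toSyn.injective (le_antisymm (h2 i) (m.le_degree (mem_support_iff.mpr hi)))
  have hq : q i ≠ 0 := by
    rintro h
    rw [h, mul_zero, coeff_zero] at hi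
    exact hi rfl
  rw [← hdeg, m.degree_mul_of_left_mem_nonZeroDivisors (hub' i).mem_nonZeroDivisors hq,
    m.degree_map_of_leadingCoeff_ne_zero φ (hub i)]
  exact self_le_add_right _ _

/-- Clearing denominators in an ideal of polynomials extended to a localization. -/
theorem MvPolynomial.exists_mem_of_mem_map_of_isLocalization {R S : Type*} [CommRing R] [CommRing S]
    [Algebra R S] (M : Submonoid R) [IsLocalization M S] (J : Ideal (MvPolynomial σ R))
    {f : MvPolynomial σ S} (hf : f ∈ J.map (MvPolynomial.map (algebraMap R S))) :
    ∃ c ∈ M, ∃ f₀ ∈ J, MvPolynomial.map (algebraMap R S) f₀ = C (algebraMap R S c) * f := by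
  let := algebraMvPolynomial (σ := σ) (R := R) (S := S)
  obtain ⟨⟨⟨f₀, hf₀⟩, ⟨_, c, hc, rfl⟩⟩, h⟩ :=
    (IsLocalization.mem_map_algebraMap_iff (M.map (C (σ := σ))) (MvPolynomial σ S)).mp hf
  refine ⟨c, hc, f₀, hf₀, ?_⟩
  rw [mul_comm, ← map_C]
  exact h.symm

/-- An ideal `J` of polynomials over a domain `A` has a finite set of elements whose leading
monomials generate those of `J`, and this remains so after every base change that makes their
leading coefficients invertible. -/
theorem MonomialOrder.exists_groebner [Finite σ] {A : Type*} [CommRing A] [IsDomain A]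
    (J : Ideal (MvPolynomial σ A)) :
    ∃ (G : Finset (MvPolynomial σ A)) (s : A), s ≠ 0 ∧
      (∀ g ∈ G, g ∈ J ∧ g ≠ 0 ∧ m.leadingCoeff g ∣ s) ∧
      ∀ {B : Type*} [CommRing B] (φ : A →+* B), IsUnit (φ s) →
        ∀ f ∈ J.map (MvPolynomial.map φ), f ≠ 0 → ∃ g ∈ G, m.degree g ≤ m.degree f := by
  classical
  let E : Set (σ →₀ ℕ) := {d | ∃ f ∈ J, f ≠ 0 ∧ m.degree f = d}
  have hfin : {d | Minimal (· ∈ E) d}.Finite :=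
    WellQuasiOrderedLE.finite_of_isAntichain (setOfPred_minimal_antichain _)
  have hmin : ∀ d : {d | Minimal (· ∈ E) d}, ∃ f ∈ J, f ≠ 0 ∧ m.degree f = d := fun d => d.2.1
  choose b hbJ hb0 hbd using hmin
  have := hfin.fintype
  have hEmin (f) (hf : f ∈ J) (hf0 : f ≠ 0) : ∃ i, m.degree (b i) ≤ m.degree f := by
    obtain ⟨d, hd, hmin⟩ := exists_minimal_le_of_wellFoundedLT (· ∈ E) (m.degree f) ⟨f, hf, hf0, rfl⟩
    exact ⟨⟨d, hmin⟩, (hbd _).trans_le hd⟩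
  let s : A := ∏ i, m.leadingCoeff (b i)
  have hs0 : s ≠ 0 := Finset.prod_ne_zero_iff.mpr fun i _ => m.leadingCoeff_ne_zero_iff.mpr (hb0 i)
  have hdvd (i) : m.leadingCoeff (b i) ∣ s := Finset.dvd_prod_of_mem _ (Finset.mem_univ i)
  refine ⟨Finset.univ.image b, s, hs0, ?_, ?_⟩
  · intro g hg
    obtain ⟨i, -, rfl⟩ := Finset.mem_image.mp hg
    exact ⟨hbJ i, hb0 i, hdvd i⟩
  intro B _ φ hφ f hf hf0
  let ι := algebraMap A (Localization.Away s)
  have hι : Function.Injective ι :=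
    IsLocalization.injective _ (powers_le_nonZeroDivisors_of_noZeroDivisors hs0)
  let ψ : Localization.Away s →+* B := IsLocalization.Away.lift s hφ
  have hψ : ψ.comp ι = φ := IsLocalization.Away.lift_comp s hφ
  have hlc (i) : ι (m.leadingCoeff (b i)) ≠ 0 := by
    rw [Ne, map_eq_zero_iff _ hι]
    exact m.leadingCoeff_ne_zero_iff.mpr (hb0 i)
  have hcomp : MvPolynomial.map (σ := σ) φ = (MvPolynomial.map ψ).comp (MvPolynomial.map ι) := by
    rw [← hψ]
    ext <;> simp
  rw [hcomp, ← Ideal.map_map] at hf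
  have hu (i) : IsUnit (m.leadingCoeff (MvPolynomial.map ι (b i))) := by
    rw [m.leadingCoeff_map_of_ne_zero ι (hlc i)]
    exact isUnit_of_dvd_unit (map_dvd ι (hdvd i)) (IsLocalization.Away.algebraMap_isUnit s)
  have hloc : ∀ f ∈ J.map (MvPolynomial.map ι), f ≠ 0 →
      ∃ i, m.degree (MvPolynomial.map ι (b i)) ≤ m.degree f := by
    intro f hf hf0
    obtain ⟨c, hc, f₀, hf₀, h⟩ :=
      exists_mem_of_mem_map_of_isLocalization (Submonoid.powers s) J hf
    have hc0 : c ≠ 0 := nonZeroDivisors.ne_zero (powers_le_nonZeroDivisors_of_noZeroDivisors hs0 hc)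
    have hcu : IsUnit (algebraMap A (Localization.Away s) c) :=
      IsLocalization.map_units (Localization.Away s) (⟨c, hc⟩ : Submonoid.powers s)
    have hf₀0 : f₀ ≠ 0 := by
      rintro rfl
      rw [map_zero] at h
      exact hf0 ((IsUnit.mul_right_eq_zero (hcu.map C)).mp h.symm)
    have hdeg : m.degree f₀ = m.degree f := by
      rw [← m.degree_map_of_leadingCoeff_ne_zero ι, h, ← smul_eq_C_mul,
        m.degree_smul_of_isRegular hcu.isRegular]
      rw [Ne, map_eq_zero_iff _ hι]
      exact m.leadingCoeff_ne_zero_iff.mpr hf₀0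
    obtain ⟨i, hi⟩ := hEmin f₀ hf₀ hf₀0
    exact ⟨i, by rwa [m.degree_map_of_leadingCoeff_ne_zero ι (hlc i), ← hdeg]⟩
  obtain ⟨i, hi⟩ := m.exists_degree_le_of_mem_map ψ _ (fun i => MvPolynomial.map ι (b i)) hu
    (fun i => Ideal.mem_map_of_mem _ (hbJ i)) hloc hf hf0
  rw [m.degree_map_of_leadingCoeff_ne_zero ι (hlc i)] at hi
  exact ⟨_, Finset.mem_image_of_mem b (Finset.mem_univ i), hi⟩

end Groebner

/-! ### Uniform bounds for saturations -/

section Saturation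

open MvPolynomial

open scoped MonomialOrder

/-- If `J` has a Gröbner basis with invertible leading coefficients, then the quotient by `J` is free
on the standard monomials, hence torsion free. -/
theorem MonomialOrder.mem_of_C_mul_mem {σ B : Type*} [CommRing B] [IsDomain B] (m : MonomialOrder σ)
    (J : Ideal (MvPolynomial σ B)) (G : Set (MvPolynomial σ B))
    (hG : ∀ g ∈ G, g ∈ J ∧ IsUnit (m.leadingCoeff g))
    (hJ : ∀ f ∈ J, f ≠ 0 → ∃ g ∈ G, m.degree g ≤ m.degree f) {c : B} (hc : c ≠ 0)
    {f : MvPolynomial σ B} (hf : C c * f ∈ J) : f ∈ J := by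
  obtain ⟨q, r, h1, -, h3⟩ := m.div_set (fun g hg => (hG g hg).2) f
  rw [Finsupp.linearCombination_apply] at h1
  have hq : (q.sum fun i a => a • (i : MvPolynomial σ B)) ∈ J :=
    J.sum_mem fun i _ => J.mul_mem_left _ (hG i i.2).1
  have hr : C c * r ∈ J := by
    rw [h1, mul_add] at hf
    exact (J.add_mem_iff_right (J.mul_mem_left _ hq)).mp hf
  have hr0 : r = 0 := by
    by_contra hr0
    obtain ⟨g, hg, hle⟩ := hJ _ hr (mul_ne_zero (C_ne_zero.mpr hc) hr0)
    rw [← smul_eq_C_mul, m.degree_smul_of_isRegular (IsRegular.of_ne_zero hc)] at hle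
    exact h3 _ (m.degree_mem_support hr0) g hg hle
  rw [h1, hr0, add_zero]
  exact hq

variable {ι : Type*} (I : Set ι)

open Classical in
/-- Polynomials in the variables `ι`, viewed as polynomials in the variables outside `I` with
coefficients in the ring of polynomials in the variables in `I`. -/
noncomputable def splitVars (R : Type*) [CommRing R] :
    MvPolynomial ι R ≃ₐ[R] MvPolynomial ↥Iᶜ (MvPolynomial I R) :=
  (renameEquiv R ((Equiv.sumComm _ _).trans (Equiv.Set.sumCompl I)).symm).trans
    (sumAlgEquiv R ↥Iᶜ I)

theorem splitVars_rename (R : Type*) [CommRing R] (g : MvPolynomial I R) :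
    splitVars I R (rename (↑) g) = C g := by
  classical
  induction g using MvPolynomial.induction_on with
  | C a => simp [splitVars]
  | add p q hp hq => simp only [map_add, hp, hq]
  | mul_X p i hp =>
    rw [map_mul, map_mul, hp, rename_X, map_mul]
    simp [splitVars]

theorem splitVars_X_compl (R : Type*) [CommRing R] (i : ↥Iᶜ) :
    splitVars I R (X i) = X i := by
  classical
  simp [splitVars, Equiv.Set.sumCompl_symm_apply_compl]

theorem splitVars_map {R B : Type*} [CommRing R] [CommRing B] (φ : R →+* B) (f : MvPolynomial ι R) :
    splitVars I B (MvPolynomial.map φ f) =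
      MvPolynomial.map (MvPolynomial.map φ) (splitVars I R f) := by
  classical
  induction f using MvPolynomial.induction_on with
  | C a => simp [splitVars]
  | add p q hp hq => simp only [map_add, hp, hq]
  | mul_X p i hp =>
    rw [map_mul, map_mul, hp, map_X, map_mul, map_mul]
    congr 1
    by_cases hi : i ∈ I
    · have h1 := splitVars_rename I R (X ⟨i, hi⟩)
      have h2 := splitVars_rename I B (X ⟨i, hi⟩)
      rw [rename_X] at h1 h2
      rw [h1, h2, map_C, map_X]
    · have h1 := splitVars_X_compl I R ⟨i, hi⟩
      have h2 := splitVars_X_compl I B ⟨i, hi⟩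
      dsimp only at h1 h2
      rw [h1, h2, map_X]

/-- The contraction of an ideal `J` from the polynomial ring over the field of rational functions in
the variables in `I` is the saturation of `J` by one polynomial `h` in these variables, uniformly
over a nonempty open set of specializations of the coefficients. -/
theorem exists_pow_mul_mem_of_mul_mem [Finite ι] {A : Type*} [CommRing A] [IsDomain A]
    (J : Ideal (MvPolynomial ι A)) :
    ∃ h : MvPolynomial I A, h ≠ 0 ∧ ∀ {κ : Type*} [Field κ] (φ : A →+* κ), MvPolynomial.map φ h ≠ 0 →
      ∀ (f : MvPolynomial ι κ) (g : MvPolynomial I κ), g ≠ 0 →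
        rename (↑) g * f ∈ J.map (MvPolynomial.map φ) →
        ∃ N : ℕ, rename (↑) (MvPolynomial.map φ h) ^ N * f ∈ J.map (MvPolynomial.map φ) := by
  classical
  have : Nonempty (LinearOrder ↥Iᶜ) := ⟨linearOrderOfSTO WellOrderingRel⟩
  obtain ⟨_⟩ := this
  let m : MonomialOrder ↥Iᶜ := MonomialOrder.lex
  obtain ⟨G, h, hh0, hG, hGB⟩ := m.exists_groebner (J.map (splitVars I A))
  refine ⟨h, hh0, fun {κ} _ φ hφ f g hg hgf => ?_⟩
  let φ' : MvPolynomial I A →+* MvPolynomial I κ := MvPolynomial.map φ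
  let B := Localization.Away (φ' h)
  let α : MvPolynomial I κ →+* B := algebraMap _ _
  have hα : Function.Injective α :=
    IsLocalization.injective _ (powers_le_nonZeroDivisors_of_noZeroDivisors hφ)
  have : IsDomain B := IsLocalization.isDomain_localization
    (powers_le_nonZeroDivisors_of_noZeroDivisors hφ)
  have hunit : IsUnit ((α.comp φ') h) := IsLocalization.Away.algebraMap_isUnit (φ' h)
  have hmap : ((J.map (MvPolynomial.map φ)).map (splitVars I κ)).map (MvPolynomial.map α) =
      (J.map (splitVars I A)).map (MvPolynomial.map (α.comp φ')) := by
    have hcomp (x : MvPolynomial ι A) : MvPolynomial.map α (splitVars I κ (MvPolynomial.map φ x)) =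
        MvPolynomial.map (α.comp φ') (splitVars I A x) := by
      rw [splitVars_map, map_map]
    apply le_antisymm
    · simp only [Ideal.map_le_iff_le_comap]
      intro x hx
      rw [Ideal.mem_comap, Ideal.mem_comap, Ideal.mem_comap, hcomp]
      exact Ideal.mem_map_of_mem _ (Ideal.mem_map_of_mem _ hx)
    · simp only [Ideal.map_le_iff_le_comap]
      intro x hx
      rw [Ideal.mem_comap, Ideal.mem_comap, ← hcomp]
      exact Ideal.mem_map_of_mem _ (Ideal.mem_map_of_mem _ (Ideal.mem_map_of_mem _ hx))
  have hlc (g) (hg : g ∈ G) : IsUnit ((α.comp φ') (m.leadingCoeff g)) :=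
    isUnit_of_dvd_unit (map_dvd _ (hG g hg).2.2) hunit
  have key : MvPolynomial.map α (splitVars I κ f) ∈
      ((J.map (MvPolynomial.map φ)).map (splitVars I κ)).map (MvPolynomial.map α) := by
    refine m.mem_of_C_mul_mem _ (MvPolynomial.map (α.comp φ') '' G) ?_ ?_ (c := α g) ?_ ?_
    · rintro _ ⟨g, hg, rfl⟩
      rw [hmap, m.leadingCoeff_map_of_ne_zero _ (hlc g hg).ne_zero]
      exact ⟨Ideal.mem_map_of_mem _ (hG g hg).1, hlc g hg⟩
    · intro f hf hf0
      rw [hmap] at hf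
      obtain ⟨g, hg, hle⟩ := hGB _ hunit f hf hf0
      exact ⟨_, ⟨g, hg, rfl⟩, by rwa [m.degree_map_of_leadingCoeff_ne_zero _ (hlc g hg).ne_zero]⟩
    · rwa [Ne, map_eq_zero_iff _ hα]
    · rw [← map_C, ← map_mul, ← splitVars_rename, ← map_mul]
      exact Ideal.mem_map_of_mem _ (Ideal.mem_map_of_mem _ hgf)
  obtain ⟨c, ⟨N, rfl⟩, f₀, hf₀, hff⟩ :=
    exists_mem_of_mem_map_of_isLocalization (Submonoid.powers (φ' h)) _ key
  refine ⟨N, ?_⟩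
  rw [← map_C, ← map_mul] at hff
  have := MvPolynomial.map_injective _ hα hff
  rw [this, ← splitVars_rename, ← map_mul] at hf₀
  rw [← map_pow]
  obtain ⟨x, hx, hxe⟩ := (Ideal.mem_map_of_equiv (splitVars I κ) _).mp hf₀
  rwa [(splitVars I κ).injective hxe] at hx

/-- The ideal `(J, 1 - u h)` of Rabinowitsch's trick, where the new variable `u` comes first. -/
noncomputable def rabinowitsch {N : ℕ} {R : Type*} [CommRing R] (J : Ideal (MvPolynomial (Fin N) R))
    (h : MvPolynomial (Fin N) R) : Ideal (MvPolynomial (Fin (N + 1)) R) :=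
  J.map (rename Fin.succ) ⊔ Ideal.span {1 - X 0 * rename Fin.succ h}

theorem rename_mem_rabinowitsch {N : ℕ} {R : Type*} [CommRing R]
    {J : Ideal (MvPolynomial (Fin N) R)} {h f : MvPolynomial (Fin N) R} {M : ℕ}
    (hf : h ^ M * f ∈ J) : rename Fin.succ f ∈ rabinowitsch J h := by
  have h1 : (X 0 : MvPolynomial (Fin (N + 1)) R) ^ M * rename Fin.succ (h ^ M * f) ∈
      rabinowitsch J h :=
    Ideal.mul_mem_left _ _ (Ideal.mem_sup_left (Ideal.mem_map_of_mem _ hf))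
  have h2 : rename Fin.succ f * (1 - (X 0 * rename Fin.succ h) ^ M) ∈ rabinowitsch J h := by
    refine Ideal.mul_mem_left _ _ (Ideal.mem_sup_right (Ideal.mem_span_singleton.mpr ?_))
    have := sub_dvd_pow_sub_pow 1 (X 0 * rename Fin.succ h) M
    rwa [one_pow] at this
  have := (rabinowitsch J h).add_mem h1 h2
  rw [map_mul, map_pow] at this
  convert this using 1
  ring

theorem exists_pow_mul_mem_of_rename_mem_rabinowitsch {N : ℕ} {R : Type*} [CommRing R]
    {J : Ideal (MvPolynomial (Fin N) R)} {h f : MvPolynomial (Fin N) R}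
    (hf : rename Fin.succ f ∈ rabinowitsch J h) : ∃ M : ℕ, h ^ M * f ∈ J := by
  let L := Localization.Away h
  let α : MvPolynomial (Fin N) R →+* L := algebraMap _ _
  let ψ : MvPolynomial (Fin (N + 1)) R →+* L :=
    eval₂Hom (α.comp C) (Fin.cases (IsLocalization.Away.invSelf h) fun i => α (X i))
  have hψ (g : MvPolynomial (Fin N) R) : ψ (rename Fin.succ g) = α g := by
    induction g using MvPolynomial.induction_on with
    | C a => simp [ψ]
    | add p q hp hq => simp only [map_add, hp, hq]
    | mul_X p i hp => rw [map_mul, map_mul, hp, rename_X, map_mul]; simp [ψ]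
  have hle : rabinowitsch J h ≤ (J.map α).comap ψ := by
    refine sup_le (Ideal.map_le_iff_le_comap.mpr fun x hx => ?_)
      ((Ideal.span_singleton_le_iff_mem _).mpr ?_)
    · rw [Ideal.mem_comap, Ideal.mem_comap]
      exact (hψ x).symm ▸ Ideal.mem_map_of_mem _ hx
    · rw [Ideal.mem_comap, map_sub, map_mul, hψ, map_one]
      have h0 : ψ (X 0) = IsLocalization.Away.invSelf h := by simp [ψ]
      rw [h0, mul_comm, IsLocalization.Away.mul_invSelf, sub_self]
      exact Ideal.zero_mem _
  have hfα := hle hf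
  rw [Ideal.mem_comap, hψ] at hfα
  obtain ⟨⟨⟨a, ha⟩, ⟨_, M, rfl⟩⟩, hc⟩ :=
    (IsLocalization.mem_map_algebraMap_iff (Submonoid.powers h) L).mp hfα
  rw [← map_mul] at hc
  obtain ⟨⟨_, M', rfl⟩, hM⟩ := (IsLocalization.eq_iff_exists (Submonoid.powers h) L).mp hc
  refine ⟨M' + M, ?_⟩
  have : h ^ (M' + M) * f = h ^ M' * (f * h ^ M) := by ring
  rw [this]
  exact hM ▸ J.mul_mem_left _ ha

theorem rabinowitsch_map {N : ℕ} {R B : Type*} [CommRing R] [CommRing B] (φ : R →+* B)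
    (J : Ideal (MvPolynomial (Fin N) R)) (h : MvPolynomial (Fin N) R) :
    (rabinowitsch J h).map (MvPolynomial.map φ) =
      rabinowitsch (J.map (MvPolynomial.map φ)) (MvPolynomial.map φ h) := by
  have h1 : (J.map (rename Fin.succ)).map (MvPolynomial.map φ) =
      (J.map (MvPolynomial.map φ)).map (rename Fin.succ) := by
    apply le_antisymm
    · simp only [Ideal.map_le_iff_le_comap]
      intro x hx
      rw [Ideal.mem_comap, Ideal.mem_comap, map_rename]
      exact Ideal.mem_map_of_mem _ (Ideal.mem_map_of_mem _ hx)
    · simp only [Ideal.map_le_iff_le_comap]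
      intro x hx
      rw [Ideal.mem_comap, Ideal.mem_comap, ← map_rename]
      exact Ideal.mem_map_of_mem _ (Ideal.mem_map_of_mem _ hx)
  rw [rabinowitsch, Ideal.map_sup, h1, Ideal.map_span, Set.image_singleton, map_sub, map_mul,
    map_rename, map_X, map_one]
  rfl

theorem MonomialOrder.lex_apply_zero_le {N : ℕ} {a b : Fin (N + 1) →₀ ℕ}
    (h : a ≼[MonomialOrder.lex] b) : a 0 ≤ b 0 := by
  rw [MonomialOrder.lex_le_iff] at h
  rcases h.eq_or_lt with h | h
  · rw [toLex.injective h]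
  · obtain ⟨i, h1, h2⟩ := Finsupp.Lex.lt_iff.mp h
    rcases eq_or_ne i 0 with rfl | hi
    · exact h2.le
    · exact (h1 0 (Fin.pos_of_ne_zero hi)).le

/-- Setting the variable `X 0` to zero. -/
noncomputable def killZero (N : ℕ) (R : Type*) [CommRing R] :
    MvPolynomial (Fin (N + 1)) R →ₐ[R] MvPolynomial (Fin N) R :=
  aeval (Fin.cases 0 X)

theorem killZero_rename {N : ℕ} {R : Type*} [CommRing R] (f : MvPolynomial (Fin N) R) :
    killZero N R (rename Fin.succ f) = f := by
  have : (killZero N R).comp (rename Fin.succ) = AlgHom.id R _ := by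
    ext i
    simp [killZero]
  exact DFunLike.congr_fun this f

theorem killZero_map {N : ℕ} {R B : Type*} [CommRing R] [CommRing B] (φ : R →+* B)
    (f : MvPolynomial (Fin (N + 1)) R) :
    killZero N B (MvPolynomial.map φ f) = MvPolynomial.map φ (killZero N R f) := by
  induction f using MvPolynomial.induction_on with
  | C a => simp [killZero]
  | add p q hp hq => simp only [map_add, hp, hq]
  | mul_X p i hp =>
    rw [map_mul, map_mul, hp, map_X, map_mul, map_mul]
    congr 1
    refine Fin.cases ?_ (fun i => ?_) i <;> simp [killZero]

theorem rename_killZero {N : ℕ} {R : Type*} [CommRing R] {f : MvPolynomial (Fin (N + 1)) R}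
    (hf : ∀ c ∈ f.support, c 0 = 0) : rename Fin.succ (killZero N R f) = f := by
  obtain ⟨g, rfl⟩ := exists_rename_eq_of_vars_subset_range f Fin.succ (Fin.succ_injective N) (by
    intro i hi
    obtain ⟨c, hc, hic⟩ := (mem_vars_iff_mem_support i).mp hi
    refine Fin.exists_succ_eq.mpr ?_
    rintro rfl
    exact Finsupp.mem_support_iff.mp hic (hf c hc))
  rw [killZero_rename]

/-- Over a nonempty open set of specializations of the coefficients, the saturation of `J` by `h`
is generated by polynomials of bounded degree: eliminate `u` from `(J, 1 - u h)` by means of a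
lexicographic Gröbner basis. -/
theorem exists_degree_bound_saturation {N : ℕ} {A : Type*} [CommRing A] [IsDomain A]
    (J : Ideal (MvPolynomial (Fin N) A)) (h : MvPolynomial (Fin N) A) :
    ∃ s : A, s ≠ 0 ∧ ∃ D : ℕ, ∀ {κ : Type*} [Field κ] (φ : A →+* κ), φ s ≠ 0 →
      ∀ (f : MvPolynomial (Fin N) κ) (M : ℕ),
        MvPolynomial.map φ h ^ M * f ∈ J.map (MvPolynomial.map φ) →
        f ∈ Ideal.span {p : MvPolynomial (Fin N) κ | p.totalDegree ≤ D ∧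
          ∃ M : ℕ, MvPolynomial.map φ h ^ M * p ∈ J.map (MvPolynomial.map φ)} := by
  classical
  let m : MonomialOrder (Fin (N + 1)) := MonomialOrder.lex
  obtain ⟨G, s, hs0, hG, hGB⟩ := m.exists_groebner (rabinowitsch J h)
  refine ⟨s, hs0, G.sup fun g => (killZero N A g).totalDegree, fun {κ} _ φ hφ f M hf => ?_⟩
  let G' : Set (MvPolynomial (Fin (N + 1)) κ) :=
    MvPolynomial.map φ '' {g | g ∈ G ∧ m.degree g 0 = 0}
  have hlc (g) (hg : g ∈ G) : φ (m.leadingCoeff g) ≠ 0 := by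
    obtain ⟨t, ht⟩ := (hG g hg).2.2
    rw [ht, map_mul] at hφ
    exact left_ne_zero_of_mul hφ
  have hG'u : ∀ g ∈ G', IsUnit (m.leadingCoeff g) := by
    rintro _ ⟨g, ⟨hg, -⟩, rfl⟩
    rw [m.leadingCoeff_map_of_ne_zero φ (hlc g hg)]
    exact (hlc g hg).isUnit
  have hG'J : ∀ g ∈ G', g ∈ (rabinowitsch J h).map (MvPolynomial.map φ) := by
    rintro _ ⟨g, ⟨hg, -⟩, rfl⟩
    exact Ideal.mem_map_of_mem _ (hG g hg).1
  have hF : rename Fin.succ f ∈ (rabinowitsch J h).map (MvPolynomial.map φ) := by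
    rw [rabinowitsch_map]
    exact rename_mem_rabinowitsch hf
  have hF0 : m.degree (rename Fin.succ f) 0 = 0 := by
    rcases eq_or_ne (rename Fin.succ f : MvPolynomial (Fin (N + 1)) κ) 0 with h0 | h0
    · rw [h0, m.degree_zero]; rfl
    · have := m.degree_mem_support h0
      rw [support_rename_of_injective (Fin.succ_injective N)] at this
      obtain ⟨c, -, hc⟩ := Finset.mem_image.mp this
      rw [← hc]
      exact Finsupp.mapDomain_of_notMem_range _ _ (by simp)
  obtain ⟨q, r, h1, h2, h3⟩ := m.div_set hG'u (rename Fin.succ f)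
  rw [Finsupp.linearCombination_apply] at h1
  have hr0 : r = 0 := by
    by_contra hr0
    have hrJ : r ∈ (rabinowitsch J h).map (MvPolynomial.map φ) := by
      rw [← sub_eq_of_eq_add' h1]
      exact Ideal.sub_mem _ hF (Ideal.sum_mem _ fun i _ => Ideal.mul_mem_left _ _ (hG'J i i.2))
    obtain ⟨g, hg, hle⟩ := hGB φ hφ.isUnit r hrJ hr0
    have hrF : m.degree r ≼[m] m.degree (rename Fin.succ f) := by
      rw [← sub_eq_of_eq_add' h1]
      refine m.degree_sub_le.trans (sup_le le_rfl ?_)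
      refine m.degree_sum_le.trans (Finset.sup_le fun i _ => ?_)
      dsimp only
      rw [smul_eq_mul, mul_comm]
      exact h2 i
    have hg0 : m.degree g 0 = 0 := by
      have h4 := MonomialOrder.lex_apply_zero_le hrF
      have h5 := hle 0
      omega
    refine h3 _ (m.degree_mem_support hr0) _ ⟨g, ⟨hg, hg0⟩, rfl⟩ ?_
    rwa [m.degree_map_of_leadingCoeff_ne_zero φ (hlc g hg)]
  rw [hr0, add_zero] at h1
  have h4 := congrArg (killZero N κ) h1
  rw [killZero_rename, Finsupp.sum, map_sum] at h4
  rw [h4]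
  refine Ideal.sum_mem _ fun i _ => ?_
  rw [smul_eq_mul, map_mul]
  refine Ideal.mul_mem_left _ _ (Ideal.subset_span ?_)
  obtain ⟨_, g, ⟨hg, hg0⟩, rfl⟩ := i
  dsimp only
  constructor
  · rw [killZero_map]
    exact (Finset.sup_mono (support_map_subset _ _)).trans (Finset.le_sup (f := fun g => (killZero N A g).totalDegree) hg)
  · apply exists_pow_mul_mem_of_rename_mem_rabinowitsch
    rw [← rabinowitsch_map, killZero_map, ← map_rename, rename_killZero]
    · exact hG'J _ ⟨g, ⟨hg, hg0⟩, rfl⟩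
    · intro c hc
      have := MonomialOrder.lex_apply_zero_le (m.le_degree hc)
      omega

/-- For an ideal `J` of polynomials over a noetherian ring `A` and all specializations of `A` to
fields, the contraction of `J` from the polynomial ring over the field of rational functions in the
variables in `I` is generated by polynomials of bounded degree. -/
theorem exists_degree_bound_contraction {N : ℕ} {A : Type*} [CommRing A] [IsNoetherianRing A]
    (J : Ideal (MvPolynomial (Fin N) A)) (I : Set (Fin N)) :
    ∃ D : ℕ, ∀ {κ : Type u} [Field κ] (φ : A →+* κ) (f : MvPolynomial (Fin N) κ)
      (g : MvPolynomial I κ), g ≠ 0 → rename (↑) g * f ∈ J.map (MvPolynomial.map φ) →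
        f ∈ Ideal.span {p : MvPolynomial (Fin N) κ | p.totalDegree ≤ D ∧
          ∃ g : MvPolynomial I κ, g ≠ 0 ∧ rename (↑) g * p ∈ J.map (MvPolynomial.map φ)} := by
  suffices ∀ 𝔞 : Ideal A, ∃ D : ℕ, ∀ {κ : Type u} [Field κ] (φ : A →+* κ), 𝔞 ≤ RingHom.ker φ →
      ∀ (f : MvPolynomial (Fin N) κ)
      (g : MvPolynomial I κ), g ≠ 0 → rename (↑) g * f ∈ J.map (MvPolynomial.map φ) →
        f ∈ Ideal.span {p : MvPolynomial (Fin N) κ | p.totalDegree ≤ D ∧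
          ∃ g : MvPolynomial I κ, g ≠ 0 ∧ rename (↑) g * p ∈ J.map (MvPolynomial.map φ)} by
    obtain ⟨D, hD⟩ := this ⊥
    exact ⟨D, fun φ => hD φ bot_le⟩
  intro 𝔞
  induction 𝔞 using WellFoundedGT.induction with
  | ind 𝔞 ih =>
  have hmono {κ : Type u} [Field κ] (φ : A →+* κ) {D D' : ℕ} (h : D ≤ D') :
      Ideal.span {p : MvPolynomial (Fin N) κ | p.totalDegree ≤ D ∧
          ∃ g : MvPolynomial I κ, g ≠ 0 ∧ rename (↑) g * p ∈ J.map (MvPolynomial.map φ)} ≤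
        Ideal.span {p : MvPolynomial (Fin N) κ | p.totalDegree ≤ D' ∧
          ∃ g : MvPolynomial I κ, g ≠ 0 ∧ rename (↑) g * p ∈ J.map (MvPolynomial.map φ)} :=
    Ideal.span_mono fun p hp => ⟨hp.1.trans h, hp.2⟩
  have hlt (a : A) (ha : a ∉ 𝔞) : 𝔞 < 𝔞 ⊔ Ideal.span {a} :=
    lt_of_le_of_ne le_sup_left fun h => ha (h ▸ Ideal.mem_sup_right (Ideal.mem_span_singleton_self a))
  have hker {κ : Type u} [Field κ] {φ : A →+* κ} {a : A} (h : 𝔞 ≤ RingHom.ker φ) (ha : φ a = 0) :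
      𝔞 ⊔ Ideal.span {a} ≤ RingHom.ker φ :=
    sup_le h ((Ideal.span_singleton_le_iff_mem _).mpr ha)
  by_cases htop : 𝔞 = ⊤
  · refine ⟨0, fun φ h => absurd (map_one φ) ?_⟩
    rw [(RingHom.mem_ker).mp (h (htop ▸ Submodule.mem_top : (1 : A) ∈ 𝔞))]
    exact zero_ne_one
  by_cases hprime : 𝔞.IsPrime
  · have : IsDomain (A ⧸ 𝔞) := Ideal.Quotient.isDomain 𝔞
    let π : A →+* A ⧸ 𝔞 := Ideal.Quotient.mk 𝔞
    let J' : Ideal (MvPolynomial (Fin N) (A ⧸ 𝔞)) := J.map (MvPolynomial.map π)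
    obtain ⟨h, hh0, hh⟩ := exists_pow_mul_mem_of_mul_mem I J'
    obtain ⟨s, hs0, D, hD⟩ := exists_degree_bound_saturation J' (rename (↑) h)
    obtain ⟨e, he⟩ := ne_zero_iff.mp hh0
    obtain ⟨t, ht⟩ := Ideal.Quotient.mk_surjective (s * coeff e h)
    have ht𝔞 : t ∉ 𝔞 := by
      rw [← Ideal.Quotient.eq_zero_iff_mem, ht]
      exact mul_ne_zero hs0 he
    obtain ⟨D', hD'⟩ := ih _ (hlt t ht𝔞)
    refine ⟨max D D', fun {κ} _ φ hφ f g hg hgf => ?_⟩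
    by_cases h0 : φ t = 0
    · exact hmono φ (le_max_right _ _) (hD' φ (hker hφ h0) f g hg hgf)
    refine hmono φ (le_max_left _ _) ?_
    let ψ : A ⧸ 𝔞 →+* κ := Ideal.Quotient.lift 𝔞 φ fun a ha => hφ ha
    have hψ : ψ.comp π = φ := Ideal.Quotient.lift_comp_mk _ _ _
    have hJ : J.map (MvPolynomial.map φ) = J'.map (MvPolynomial.map ψ) := by
      have hcomp : MvPolynomial.map (σ := Fin N) φ =
          (MvPolynomial.map ψ).comp (MvPolynomial.map π) := by
        rw [← hψ]
        ext <;> simp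
      rw [Ideal.map_map, ← hcomp]
    have hψt : ψ s * ψ (coeff e h) ≠ 0 := by
      rw [← map_mul, ← ht]
      exact h0
    have hψh : MvPolynomial.map ψ h ≠ 0 := by
      rw [ne_zero_iff]
      exact ⟨e, by rw [coeff_map]; exact right_ne_zero_of_mul hψt⟩
    rw [hJ] at hgf ⊢
    obtain ⟨M, hM⟩ := hh ψ hψh f g hg hgf
    rw [← map_rename] at hM
    refine Ideal.span_mono ?_ (hD ψ (left_ne_zero_of_mul hψt) f M hM)
    rintro p ⟨hp, M, hM⟩
    refine ⟨hp, MvPolynomial.map ψ h ^ M, pow_ne_zero _ hψh, ?_⟩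
    rwa [map_pow, ← map_rename]
  · obtain ⟨a, ha, b, hb, hab⟩ := (Ideal.not_isPrime_iff.mp hprime).resolve_left htop
    obtain ⟨D, hD⟩ := ih _ (hlt a ha)
    obtain ⟨D', hD'⟩ := ih _ (hlt b hb)
    refine ⟨max D D', fun {κ} _ φ hφ f g hg hgf => ?_⟩
    have hab0 : φ a * φ b = 0 := by
      rw [← map_mul]
      exact hφ hab
    rcases mul_eq_zero.mp hab0 with h0 | h0
    · exact hmono φ (le_max_left _ _) (hD φ (hker hφ h0) f g hg hgf)
    · exact hmono φ (le_max_right _ _) (hD' φ (hker hφ h0) f g hg hgf)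

end Saturation

/-! ### Equations of a separable point by its linear projections -/

section SeparablePoint

open MvPolynomial

/-- The ideal generated by the equations `F (∑ λⱼ Xⱼ)`, where `F` is the minimal polynomial of the
linear projection `∑ λⱼ zⱼ` and `λ` runs over the vectors with entries in a subfield `k`. -/
noncomputable def projectionIdeal (k K : Type*) {L τ : Type*} [Field k] [Field K] [Field L]
    [Algebra k K] [Algebra K L] [Algebra k L] [Fintype τ] (z : τ → L) : Ideal (MvPolynomial τ K) :=
  Ideal.span (Set.range fun l : τ → k =>
    Polynomial.aeval (∑ j, l j • (X j : MvPolynomial τ K)) (minpoly K (∑ j, l j • z j)))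

variable {k K L τ : Type*} [Field k] [Field K] [Field L]
    [Algebra k K] [Algebra K L] [Algebra k L] [IsScalarTower k K L] [Fintype τ] (z : τ → L)

/-- A geometric point `ψ` on which the equations of the linear projections of `z` vanish is a
conjugate of `z`: for every projection some conjugate of `z` has the same image as `ψ`, and as
a vector space over an infinite field is not a finite union of proper subspaces, one conjugate does
so for all projections. -/
theorem exists_algHom_of_projectionIdeal [Infinite k] [FiniteDimensional K L] {Ω : Type*}
    [Field Ω] [IsAlgClosed Ω] [Algebra K Ω] (ψ : MvPolynomial τ K →ₐ[K] Ω)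
    (hψ : ∀ p ∈ projectionIdeal k K z, ψ p = 0) :
    ∃ σ : L →ₐ[K] Ω, ψ = σ.comp (aeval z) := by
  classical
  let := ((algebraMap K Ω).comp (algebraMap k K)).toAlgebra
  have : IsScalarTower k K Ω := IsScalarTower.of_algebraMap_eq fun _ => rfl
  -- the vectors whose projections do not separate `ψ` from the conjugate `σ` of `z`
  let W (σ : L →ₐ[K] Ω) : Submodule k (τ → k) :=
    LinearMap.ker (∑ j, (LinearMap.toSpanSingleton k Ω (ψ (X j) - σ (z j))).comp (LinearMap.proj j))
  have hW (σ : L →ₐ[K] Ω) (l : τ → k) : l ∈ W σ ↔ ∑ j, l j • (ψ (X j) - σ (z j)) = 0 := by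
    simp [W]
  have hcov : ⋃ σ, (W σ : Set (τ → k)) = Set.univ := by
    refine Set.eq_univ_of_forall fun l => Set.mem_iUnion.mpr ?_
    have h := hψ _ (Ideal.subset_span ⟨l, rfl⟩)
    dsimp only at h
    rw [← Polynomial.aeval_algHom_apply] at h
    have hroot : ψ (∑ j, l j • (X j : MvPolynomial τ K)) ∈
        (minpoly K (∑ j, l j • z j)).rootSet Ω := by
      rw [Polynomial.mem_rootSet]
      exact ⟨minpoly.ne_zero (Algebra.IsIntegral.isIntegral _), h⟩
    rw [← Algebra.IsAlgebraic.range_eval_eq_rootSet_minpoly] at hroot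
    obtain ⟨σ, hσ⟩ := hroot
    refine ⟨σ, (hW σ l).mpr ?_⟩
    dsimp only at hσ
    have h1 : σ (∑ j, l j • z j) = ∑ j, l j • σ (z j) := by
      rw [map_sum]
      exact Finset.sum_congr rfl fun j _ => map_smul (σ.restrictScalars k) _ _
    have h2 : ψ (∑ j, l j • (X j : MvPolynomial τ K)) = ∑ j, l j • ψ (X j) := by
      rw [map_sum]
      exact Finset.sum_congr rfl fun j _ => map_smul (ψ.restrictScalars k) _ _
    simp only [smul_sub, Finset.sum_sub_distrib]
    rw [← h1, ← h2, hσ, sub_self]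
  obtain ⟨σ, hσ⟩ := Subspace.exists_eq_top_of_iUnion_eq_univ hcov
  refine ⟨σ, MvPolynomial.algHom_ext fun j => ?_⟩
  have : Pi.single j 1 ∈ W σ := hσ ▸ Submodule.mem_top
  rw [hW] at this
  simpa [Pi.single_apply, sub_eq_zero] using this

/-- A point with coordinates `z` in a separable extension `L` of `K` is cut out by the equations of
its linear projections with coefficients in an infinite subfield. The quotient of the polynomial
ring by these equations is unramified over `K`, hence reduced, and all its geometric points
are conjugate to `z`. -/
theorem mem_projectionIdeal [Infinite k] [FiniteDimensional K L] [Algebra.IsSeparable K L]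
    {p : MvPolynomial τ K} (hp : aeval z p = 0) : p ∈ projectionIdeal k K z := by
  classical
  let J := projectionIdeal k K z
  let B := MvPolynomial τ K ⧸ J
  let b (j : τ) : B := Ideal.Quotient.mk J (X j)
  have hroot (j : τ) : Polynomial.aeval (b j) (minpoly K (z j)) = 0 := by
    have h : Polynomial.aeval (X j : MvPolynomial τ K) (minpoly K (z j)) ∈ J := by
      refine Ideal.subset_span ⟨Pi.single j 1, ?_⟩
      simp [Pi.single_apply]
    have h2 := Polynomial.aeval_algHom_apply (Ideal.Quotient.mkₐ K J) (X j) (minpoly K (z j))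
    exact h2.trans (Ideal.Quotient.eq_zero_iff_mem.mpr h)
  have hsurj : Function.Surjective (Ideal.Quotient.mkₐ K J) := Ideal.Quotient.mk_surjective
  have hunr : Algebra.FormallyUnramified K B := by
    rw [Algebra.formallyUnramified_iff]
    have hD (x : B) : KaehlerDifferential.D K B x = 0 := by
      obtain ⟨q, rfl⟩ := hsurj x
      induction q using MvPolynomial.induction_on with
      | C a => exact Derivation.map_algebraMap _ a
      | add p q hp hq => rw [map_add, map_add, hp, hq, add_zero]
      | mul_X p j hp =>
        have hj : KaehlerDifferential.D K B (b j) = 0 := by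
          have h1 := (KaehlerDifferential.D K B).map_aeval (minpoly K (z j)) (b j)
          rw [hroot, map_zero] at h1
          obtain ⟨u, v, huv⟩ := Algebra.IsSeparable.isSeparable K (z j)
          have h2 := congrArg (Polynomial.aeval (b j)) huv
          rw [map_add, map_mul, map_mul, hroot, mul_zero, zero_add, map_one] at h2
          rw [← one_smul B (KaehlerDifferential.D K B (b j)), ← h2, mul_smul, ← h1, smul_zero]
        rw [map_mul, Derivation.leibniz, hp, smul_zero, add_zero]
        exact (congrArg _ hj).trans (smul_zero _)
    rw [← Submodule.subsingleton_iff B, ← subsingleton_iff_bot_eq_top,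
      ← KaehlerDifferential.span_range_derivation, eq_comm, Submodule.span_eq_bot]
    rintro _ ⟨x, rfl⟩
    exact hD x
  have hred : _root_.IsReduced B := Algebra.FormallyUnramified.isReduced_of_field K B
  have hrad : J.IsRadical := (Ideal.isRadical_iff_quotient_reduced J).mpr hred
  refine hrad ?_
  rw [Ideal.radical_eq_sInf, Submodule.mem_sInf]
  rintro Q ⟨hJQ, hQ : Ideal.IsPrime (Q : Ideal (MvPolynomial τ K))⟩
  let S := MvPolynomial τ K ⧸ (Q : Ideal (MvPolynomial τ K))
  have hint : Algebra.IsIntegral K S := by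
    constructor
    intro x
    obtain ⟨q, rfl⟩ := Ideal.Quotient.mkₐ_surjective K (Q : Ideal (MvPolynomial τ K)) x
    induction q using MvPolynomial.induction_on with
    | C a => exact isIntegral_algebraMap
    | add p q hp hq => rw [map_add]; exact hp.add hq
    | mul_X p j hp =>
      rw [map_mul]
      refine hp.mul ⟨minpoly K (z j), minpoly.monic (Algebra.IsIntegral.isIntegral _), ?_⟩
      have h2 := Polynomial.aeval_algHom_apply
        (Ideal.Quotient.mkₐ K (Q : Ideal (MvPolynomial τ K))) (X j) (minpoly K (z j))
      refine h2.trans (Ideal.Quotient.eq_zero_iff_mem.mpr (hJQ ?_))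
      refine Ideal.subset_span ⟨Pi.single j 1, ?_⟩
      simp [Pi.single_apply]
  have hfield : IsField S := isField_of_isIntegral_of_isField' (Field.toIsField K)
  let ι : S →ₐ[K] AlgebraicClosure K := IsAlgClosed.lift
  let ψ : MvPolynomial τ K →ₐ[K] AlgebraicClosure K := ι.comp (Ideal.Quotient.mkₐ K Q)
  obtain ⟨σ, hσ⟩ := exists_algHom_of_projectionIdeal (k := k) z ψ fun q hq => by
    have : Ideal.Quotient.mkₐ K Q q = 0 := Ideal.Quotient.eq_zero_iff_mem.mpr (hJQ hq)
    simp only [ψ, AlgHom.comp_apply, this, map_zero]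
  have h0 : ψ p = 0 := by rw [hσ, AlgHom.comp_apply, hp, map_zero]
  simp only [ψ, AlgHom.comp_apply] at h0
  by_contra hpQ
  obtain ⟨y, hy⟩ := hfield.mul_inv_cancel (a := Ideal.Quotient.mkₐ K Q p) fun h =>
    hpQ (Ideal.Quotient.eq_zero_iff_mem.mp h)
  have h1 := congrArg ι hy
  rw [map_mul, h0, zero_mul, map_one] at h1
  exact zero_ne_one h1

end SeparablePoint

/-! ### Separating transcendence bases among given generators -/

section SeparatingTranscendenceBasis

open IntermediateField

/-- A finite family of generators of a field extension of a perfect field contains a separating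
transcendence basis. -/
theorem exists_set_isTranscendenceBasis_and_isSeparable {k L ι : Type*} [Field k] [PerfectField k]
    [Field L] [Algebra k L] [Finite ι] (a : ι → L) (ha : adjoin k (Set.range a) = ⊤) :
    ∃ s : Set ι, IsTranscendenceBasis k (fun i : s => a i) ∧
      Algebra.IsSeparable (adjoin k (a '' s)) L := by
  classical
  have hne : {s : Set ι | IsTranscendenceBasis k (fun i : s => a i)}.Nonempty := by
    have : Algebra.IsAlgebraic (Algebra.adjoin k (Set.range a)) L := by
      rw [← isAlgebraic_adjoin_iff_top, ha, Algebra.isAlgebraic_iff_isIntegral]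
      exact Algebra.isIntegral_of_surjective topEquiv.surjective
    obtain ⟨t, hts, ht⟩ := exists_isTranscendenceBasis_subset (R := k) (Set.range a)
    choose g hg using fun x : t => hts x.2
    have hgi : Function.Injective g := fun x y h => Subtype.ext (by rw [← hg x, ← hg y, h])
    refine ⟨Set.range g, ?_⟩
    have h := ht.comp_equiv (Equiv.ofInjective g hgi).symm
    have he : Subtype.val ∘ (Equiv.ofInjective g hgi).symm = fun i : Set.range g => a i := by
      funext i
      obtain ⟨x, rfl⟩ := (Equiv.ofInjective g hgi).surjective i
      simp [hg]
    rwa [he] at h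
  -- Among the bases contained in the family, the separable closure in `L` of the field generated is
  -- largest for `s`. A generator `a n` outside that closure could be exchanged for a member of `s`,
  -- and this would enlarge the closure.
  obtain ⟨s, hs, hmax⟩ := (Set.toFinite _).exists_maximalFor
    (fun s => (separableClosure (adjoin k (a '' s)) L).restrictScalars k) _ hne
  refine ⟨s, hs, ?_⟩
  have halg : Algebra.IsAlgebraic (adjoin k (a '' s)) L := by
    convert! hs.isAlgebraic_field
    all_goals simp [Set.image_eq_range]
  obtain _ | ⟨p, hp, hpk⟩ := CharP.exists' k
  · have : CharZero (adjoin k (a '' s)) := charZero_of_injective_algebraMap (algebraMap k _).injective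
    infer_instance
  have : ExpChar k p := .prime hp.out
  have : CharP L p := .of_ringHom_of_ne_zero (algebraMap k L) p hp.out.ne_zero
  -- as `k` is perfect, the Frobenius map of `L` preserves linear independence over `k`
  have H : ∀ s : Finset L, LinearIndepOn k _root_.id (s : Set L) →
      LinearIndepOn k (· ^ p) (s : Set L) := by
    intro s hs
    refine hs.map_of_injective_injective (frobeniusEquiv k p).symm (frobenius L p).toAddMonoidHom
      (fun r hr => ?_) (fun x hx => ?_) fun r x => ?_
    · simpa using hr
    · exact eq_zero_of_pow_eq_zero hx
    · change ((frobeniusEquiv k p).symm r • x) ^ p = r • x ^ p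
      rw [Algebra.smul_def, mul_pow, ← map_pow, frobeniusEquiv_symm_pow_p, Algebra.smul_def]
  have hall (n : ι) : a n ∈ (separableClosure (adjoin k (a '' s)) L).restrictScalars k := by
    by_contra hn
    have hns : n ∉ s := fun h =>
      hn (le_restrictScalars_separableClosure _ (subset_adjoin _ _ ⟨n, h, rfl⟩))
    obtain ⟨i, hi₁, hi₂⟩ := exists_isTranscendenceBasis_and_isSeparable_of_linearIndepOn_pow'
      p hp.out (a := a) H s n hs hns
    have hle := hmax hi₁ ?_
    · apply hn
      apply hle
      obtain rfl | ne := eq_or_ne n i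
      exacts [hi₂, le_restrictScalars_separableClosure _ (subset_adjoin _ _ ⟨n, ⟨.inl rfl, ne⟩, rfl⟩)]
    · beta_reduce
      rw [separableClosure_le_separableClosure_iff, adjoin_le_iff]
      rintro _ ⟨x, hx, rfl⟩
      obtain rfl | ne := eq_or_ne x i
      exacts [hi₂, le_restrictScalars_separableClosure _ (subset_adjoin _ _ ⟨x, ⟨.inr hx, ne⟩, rfl⟩)]
  rw [← separableClosure.eq_top_iff, ← (restrictScalars_injective k).eq_iff,
    restrictScalars_top, eq_top_iff, ← ha, adjoin_le_iff]
  rintro _ ⟨x, rfl⟩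
  exact hall x

end SeparatingTranscendenceBasis

/-! ### Upper bounds for Hilbert functions -/

section HilbertUpperBound

open MvPolynomial

/-- The Hilbert function is bounded by the number of monomials which are not leading monomials of
elements of the ideal. -/
theorem hilbertFunction_le_card {n : ℕ} {k : Type u} [Field k]
    (P : HomogeneousIdeal (homogeneousSubmodule (Fin (n + 1)) k)) (m : ℕ)
    (T : Finset (Fin (n + 1) →₀ ℕ)) (hTm : ∀ a ∈ T, a.degree = m)
    (hT : ∀ a : Fin (n + 1) →₀ ℕ, a.degree = m → a ∉ T → ∃ p ∈ P.toIdeal, p.IsHomogeneous m ∧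
      p ≠ 0 ∧ MonomialOrder.lex.degree p = a) :
    hilbertFunction P m ≤ T.card := by
  classical
  let V := homogeneousSubmodule (Fin (n + 1)) k m
  let N : Submodule k V := (P.toIdeal.restrictScalars k).comap V.subtype
  have hmem (a : Fin (n + 1) →₀ ℕ) (ha : a.degree = m) : monomial a (1 : k) ∈ V :=
    (mem_homogeneousSubmodule _ _).2 (isHomogeneous_monomial _ ha)
  let b : T → V ⧸ N := fun a => N.mkQ ⟨monomial a.1 1, hmem _ (hTm _ a.2)⟩
  let U : Submodule k V := (Submodule.span k (Set.range b)).comap N.mkQ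
  have hmon : ∀ a : Fin (n + 1) →₀ ℕ, a.degree = m → monomial a (1 : k) ∈ U.map V.subtype := by
    intro a
    induction h : MonomialOrder.lex.toSyn a using WellFoundedLT.induction generalizing a with
    | ind s ih =>
    subst h
    intro ha
    by_cases haT : a ∈ T
    · exact ⟨⟨monomial a 1, hmem a ha⟩, Submodule.subset_span ⟨⟨a, haT⟩, rfl⟩, rfl⟩
    obtain ⟨p, hpP, hpm, hp0, rfl⟩ := hT a ha haT
    have hpU : p ∈ U.map V.subtype := by
      refine ⟨⟨p, hpm⟩, ?_, rfl⟩
      have : N.mkQ ⟨p, hpm⟩ = 0 := (Submodule.Quotient.mk_eq_zero N).2 hpP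
      change N.mkQ ⟨p, hpm⟩ ∈ Submodule.span k (Set.range b)
      rw [this]
      exact zero_mem _
    have hlc : MonomialOrder.lex.leadingCoeff p ≠ 0 :=
      MonomialOrder.leadingCoeff_ne_zero_iff.2 hp0
    have hd : MonomialOrder.lex.degree p ∈ p.support :=
      MonomialOrder.degree_mem_support hp0
    have hsum := p.support_sum_monomial_coeff
    rw [← Finset.add_sum_erase _ _ hd] at hsum
    have hrest : ∑ x ∈ p.support.erase (MonomialOrder.lex.degree p), monomial x (p.coeff x) ∈
        U.map V.subtype := by
      refine Submodule.sum_mem _ fun x hx => ?_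
      obtain ⟨hxne, hxs⟩ := Finset.mem_erase.1 hx
      have : monomial x (p.coeff x) = p.coeff x • monomial x (1 : k) := by
        rw [smul_monomial, smul_eq_mul, mul_one]
      rw [this]
      refine Submodule.smul_mem _ _ (ih _ ?_ x rfl ?_)
      · refine lt_of_le_of_ne (MonomialOrder.le_degree hxs) fun h => hxne ?_
        exact MonomialOrder.lex.toSyn.injective h
      · rw [Finsupp.degree_eq_weight_one]
        exact hpm (mem_support_iff.1 hxs)
    have hlead : monomial (MonomialOrder.lex.degree p) (p.coeff (MonomialOrder.lex.degree p)) ∈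
        U.map V.subtype := by
      rw [eq_sub_of_add_eq hsum]
      exact sub_mem hpU hrest
    have : monomial (MonomialOrder.lex.degree p) (1 : k) =
        (p.coeff (MonomialOrder.lex.degree p))⁻¹ • monomial (MonomialOrder.lex.degree p)
          (p.coeff (MonomialOrder.lex.degree p)) := by
      rw [smul_monomial, smul_eq_mul]
      exact congrArg _ (inv_mul_cancel₀ hlc).symm
    rw [this]
    exact Submodule.smul_mem _ _ hlead
  have htop : Submodule.span k (Set.range b) = ⊤ := by
    rw [eq_top_iff]
    rintro y -
    obtain ⟨⟨v, hv⟩, rfl⟩ := N.mkQ_surjective y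
    have hvU : v ∈ U.map V.subtype := by
      rw [← v.support_sum_monomial_coeff]
      refine Submodule.sum_mem _ fun x hx => ?_
      have : monomial x (v.coeff x) = v.coeff x • monomial x (1 : k) := by
        rw [smul_monomial, smul_eq_mul, mul_one]
      rw [this]
      refine Submodule.smul_mem _ _ (hmon x ?_)
      rw [Finsupp.degree_eq_weight_one]
      exact ((mem_homogeneousSubmodule _ _).1 hv) (mem_support_iff.1 hx)
    obtain ⟨w, hw, hwv⟩ := hvU
    obtain rfl : w = ⟨v, hv⟩ := Subtype.ext hwv
    exact hw
  have := finrank_range_le_card (R := k) b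
  rw [Set.finrank, htop, finrank_top, Fintype.card_coe] at this
  exact this

/-- The number of exponents of total degree `m` with at most `r` entries `≥ N` is at most a
constant multiple of `(m + 1) ^ (r - 1)`. -/
theorem exists_finset_card_le_of_few_large_entries (n N r : ℕ) (hr : 0 < r) :
    ∃ C : ℕ, ∀ m : ℕ, ∃ T : Finset (Fin (n + 1) →₀ ℕ), T.card ≤ C * (m + 1) ^ (r - 1) ∧
      ∀ a, a ∈ T ↔ a.degree = m ∧ (Finset.univ.filter fun i => N ≤ a i).card ≤ r := by
  classical
  refine ⟨∑ p : Finset (Fin (n + 1)) × Fin (n + 1), (N + 1) ^ (n + 1), fun m => ?_⟩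
  let T : Finset (Fin (n + 1) →₀ ℕ) := (Finset.univ.finsuppAntidiag m).filter
    fun a => (Finset.univ.filter fun i => N ≤ a i).card ≤ r
  have hT (a) : a ∈ T ↔ a.degree = m ∧ (Finset.univ.filter fun i => N ≤ a i).card ≤ r := by
    simp [T, Finsupp.degree_eq_sum]
  refine ⟨T, ?_, hT⟩
  let R (p : Finset (Fin (n + 1)) × Fin (n + 1)) : Finset (Fin (n + 1) →₀ ℕ) :=
    T.filter fun a => p.1.card ≤ r - 1 ∧ ∀ i, i ∉ p.1 → i ≠ p.2 → a i < N
  have hsub : T ⊆ Finset.univ.biUnion R := by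
    intro a ha
    have hcard := ((hT a).1 ha).2
    rw [Finset.mem_biUnion]
    by_cases h : (Finset.univ.filter fun i => N ≤ a i).Nonempty
    · obtain ⟨i, hi⟩ := h
      refine ⟨((Finset.univ.filter fun i => N ≤ a i).erase i, i), Finset.mem_univ _,
        Finset.mem_filter.2 ⟨ha, ?_, fun j hj hji => ?_⟩⟩
      · rw [Finset.card_erase_of_mem hi]; omega
      · simpa [hji] using hj
    · refine ⟨(∅, 0), Finset.mem_univ _, Finset.mem_filter.2 ⟨ha, by simp, fun j _ _ => ?_⟩⟩
      by_contra hj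
      exact h ⟨j, by simpa using hj⟩
  have hR (p) : (R p).card ≤ (N + 1) ^ (n + 1) * (m + 1) ^ (r - 1) := by
    by_cases hp : p.1.card ≤ r - 1
    swap
    · have : R p = ∅ := Finset.filter_eq_empty_iff.2 fun a _ h => hp h.1
      simp [this]
    let box : Finset (Fin (n + 1) → ℕ) := Fintype.piFinset fun i =>
      if i = p.2 then {0} else if i ∈ p.1 then Finset.range (m + 1) else Finset.range N
    -- the entry at `p.2` is determined by the other ones, as the total degree is `m`
    have hinj : (R p).card ≤ box.card := by
      refine Finset.card_le_card_of_injOn (fun a i => if i = p.2 then 0 else a i) ?_ ?_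
      · intro a ha
        obtain ⟨haT, -, ha⟩ := Finset.mem_filter.1 ha
        have hdeg := ((hT a).1 haT).1
        refine Fintype.mem_piFinset.2 fun i => ?_
        dsimp only
        split_ifs with h1 h2
        · simp
        · have := Finsupp.le_degree i a
          rw [Finset.mem_range]; omega
        · exact Finset.mem_range.2 (ha i h2 h1)
      · intro a ha b hb hab
        have hda := ((hT a).1 (Finset.mem_filter.1 ha).1).1
        have hdb := ((hT b).1 (Finset.mem_filter.1 hb).1).1
        have hne (i) (hi : i ≠ p.2) : a i = b i := by
          have := congrFun hab i
          simpa [hi] using this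
        ext i
        by_cases hi : i = p.2
        · subst hi
          rw [Finsupp.degree_eq_sum, ← Finset.add_sum_erase _ _ (Finset.mem_univ p.2)] at hda hdb
          have hs : (Finset.univ.erase p.2).sum a = (Finset.univ.erase p.2).sum b :=
            Finset.sum_congr rfl fun i hi => hne i (Finset.ne_of_mem_erase hi)
          have hab : a p.2 + (Finset.univ.erase p.2).sum a =
            b p.2 + (Finset.univ.erase p.2).sum b := hda.trans hdb.symm
          omega
        · exact hne i hi
    refine hinj.trans ?_
    rw [Fintype.card_piFinset]
    calc ∏ i, (if i = p.2 then ({0} : Finset ℕ) else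
            if i ∈ p.1 then Finset.range (m + 1) else Finset.range N).card
        ≤ ∏ i, (N + 1) * (if i ∈ p.1 then (m + 1) else 1) := by
          refine Finset.prod_le_prod' fun i _ => ?_
          split_ifs <;> simp <;> nlinarith
      _ = (N + 1) ^ (n + 1) * (m + 1) ^ p.1.card := by
          rw [Finset.prod_mul_distrib, Finset.prod_ite_mem]
          simp
      _ ≤ _ := Nat.mul_le_mul_left _ (Nat.pow_le_pow_right (by omega) hp)
  calc T.card ≤ (Finset.univ.biUnion R).card := Finset.card_le_card hsub
    _ ≤ ∑ p, (R p).card := Finset.card_biUnion_le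
    _ ≤ ∑ p : Finset (Fin (n + 1)) × Fin (n + 1), (N + 1) ^ (n + 1) * (m + 1) ^ (r - 1) :=
        Finset.sum_le_sum fun p _ => hR p
    _ = _ := by rw [Finset.sum_mul]

/-- If any `r + 1` of the variables are algebraically dependent modulo the homogeneous ideal `P`,
then the Hilbert function of `P` grows at most like a polynomial of degree `r - 1`. -/
theorem exists_hilbertFunction_le {n : ℕ} {k : Type u} [Field k]
    (P : HomogeneousIdeal (homogeneousSubmodule (Fin (n + 1)) k)) (r : ℕ) (hr : 0 < r)
    (h : ∀ I : Finset (Fin (n + 1)), r < I.card →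
      ∃ g : MvPolynomial I k, g ≠ 0 ∧ rename (↑) g ∈ P.toIdeal) :
    ∃ C : ℕ, ∀ m, hilbertFunction P m ≤ C * (m + 1) ^ (r - 1) := by
  classical
  have h' (I : Finset (Fin (n + 1))) (hI : r < I.card) : ∃ p ∈ P.toIdeal, p ≠ 0 ∧
      p.vars ⊆ I ∧ ∃ e, p.IsHomogeneous e := by
    obtain ⟨g, hg0, hgP⟩ := h I hI
    obtain ⟨e, he⟩ : ∃ e, homogeneousComponent e g ≠ 0 := by
      by_contra! hall
      exact hg0 (by rw [← g.sum_homogeneousComponent]; exact Finset.sum_eq_zero fun i _ => hall i)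
    refine ⟨rename (↑) (homogeneousComponent e g), ?_, ?_, ?_, e,
      (homogeneousComponent_isHomogeneous e g).rename_isHomogeneous⟩
    · rw [rename_homogeneousComponent]
      exact homogeneousComponent_mem_of_mem P.isHomogeneous hgP _
    · rw [Ne, map_eq_zero_iff _ (rename_injective _ Subtype.val_injective)]
      exact he
    · intro i hi
      obtain ⟨j, -, rfl⟩ := Finset.mem_image.1 (vars_rename _ _ hi)
      exact j.2
  choose! p hpP hp0 hpv e hpe using h'
  let N := ∑ I, ((p I).totalDegree + 1)
  obtain ⟨C, hC⟩ := exists_finset_card_le_of_few_large_entries n N r hr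
  refine ⟨C, fun m => ?_⟩
  obtain ⟨T, hTC, hT⟩ := hC m
  refine (hilbertFunction_le_card P m T (fun a ha => ((hT a).1 ha).1) fun a ha haT => ?_).trans hTC
  have hcard : r < (Finset.univ.filter fun i => N ≤ a i).card := by
    by_contra hlt
    exact haT ((hT a).2 ⟨ha, not_lt.1 hlt⟩)
  set I := Finset.univ.filter fun i => N ≤ a i with hI
  have hd := MonomialOrder.degree_mem_support (m := MonomialOrder.lex) (hp0 I hcard)
  set b := MonomialOrder.lex.degree (p I) with hb
  have hle : b ≤ a := by
    intro i
    by_cases hi : i ∈ I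
    · refine le_trans ?_ (Finset.mem_filter.1 hi).2
      calc b i ≤ b.degree := Finsupp.le_degree i b
        _ ≤ (p I).totalDegree := le_totalDegree hd
        _ ≤ (p I).totalDegree + 1 := Nat.le_succ _
        _ ≤ N := Finset.single_le_sum (f := fun I => (p I).totalDegree + 1)
          (fun _ _ => Nat.zero_le _) (Finset.mem_univ I)
    · have : b i = 0 := by
        by_contra h0
        exact hi (hpv I hcard ((mem_vars_iff_mem_support i).2 ⟨b, hd, Finsupp.mem_support_iff.2 h0⟩))
      rw [this]; exact Nat.zero_le _
  refine ⟨monomial (a - b) 1 * p I, P.toIdeal.mul_mem_left _ (hpP I hcard), ?_, ?_, ?_⟩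
  · have hbe : b.degree = e I := by
      rw [Finsupp.degree_eq_weight_one]
      exact hpe I hcard (mem_support_iff.1 hd)
    have := (isHomogeneous_monomial (1 : k) (rfl : (a - b).degree = _)).mul (hpe I hcard)
    convert this
    rw [← ha, ← hbe, ← map_add, tsub_add_cancel_of_le hle]
  · exact mul_ne_zero (by simp) (hp0 I hcard)
  · rw [MonomialOrder.degree_mul (by simp) (hp0 I hcard), MonomialOrder.degree_monomial,
      if_neg one_ne_zero, ← hb, tsub_add_cancel_of_le hle]

end HilbertUpperBound

/-! ### Lower bounds for Hilbert functions and the degree -/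

section HilbertLowerBound

open MvPolynomial

/-- A generator of a homogeneous principal ideal of a polynomial ring over a field is
homogeneous. -/
theorem MvPolynomial.isHomogeneous_of_span_singleton {τ k : Type*} [Field k]
    (G : MvPolynomial τ k)
    (hG : ∀ i, homogeneousComponent i G ∈ Ideal.span {G}) : G.IsHomogeneous G.totalDegree := by
  classical
  by_cases hG0 : G = 0
  · subst hG0; exact isHomogeneous_zero _ _ _
  obtain ⟨d, hd, hde⟩ : ∃ d ∈ G.support, d.degree = G.totalDegree := by
    obtain ⟨d, hd, h⟩ := Finset.exists_mem_eq_sup G.support (support_nonempty.2 hG0)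
      (fun s => s.sum fun _ e => e)
    exact ⟨d, hd, h.symm⟩
  obtain ⟨h, hh⟩ := Ideal.mem_span_singleton.1 (hG G.totalDegree)
  have hne : homogeneousComponent G.totalDegree G ≠ 0 := by
    intro h0
    have := coeff_homogeneousComponent G.totalDegree G d
    rw [h0, if_pos hde, coeff_zero] at this
    exact mem_support_iff.1 hd this.symm
  have hh0 : h ≠ 0 := by rintro rfl; exact hne (by rw [hh, mul_zero])
  have hdeg : h.totalDegree = 0 := by
    have h1 := totalDegree_mul_of_isDomain hG0 hh0
    have h2 := (homogeneousComponent_isHomogeneous G.totalDegree G).totalDegree_le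
    rw [hh, h1] at h2
    omega
  rw [totalDegree_eq_zero_iff_eq_C] at hdeg
  have hc : h.coeff 0 ≠ 0 := fun h0 => hh0 (by rw [hdeg, h0, C_0])
  have : G = C (h.coeff 0)⁻¹ * homogeneousComponent G.totalDegree G := by
    rw [hh, hdeg, coeff_C, if_pos rfl, mul_left_comm, ← C_mul, inv_mul_cancel₀ hc, C_1, mul_one]
  have h3 := (isHomogeneous_C τ (h.coeff 0)⁻¹).mul
    (homogeneousComponent_isHomogeneous G.totalDegree G)
  rw [zero_add, ← this] at h3
  exact h3

theorem MvPolynomial.finrank_homogeneousSubmodule (τ k : Type*) [Fintype τ] [Field k] (m : ℕ) :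
    Module.finrank k (homogeneousSubmodule τ k m) = (Fintype.card τ).multichoose m := by
  classical
  have h : homogeneousSubmodule τ k m = restrictSupport k {d : τ →₀ ℕ | d.degree = m} :=
    homogeneousSubmodule_eq_finsupp_supported τ k m
  rw [h, Module.finrank_eq_nat_card_basis (basisRestrictSupport k _)]
  have : {d : τ →₀ ℕ | d.degree = m} = ↑(Finset.univ.finsuppAntidiag m : Finset (τ →₀ ℕ)) := by
    ext d
    simp [Finsupp.degree_eq_sum]
  rw [this, Nat.card_eq_card_toFinset, Finset.toFinset_coe,
    Finset.card_finsuppAntidiag_nat_eq_multichoose, Finset.card_univ]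

theorem MvPolynomial.homogeneousComponent_aeval {σ τ k : Type*} [CommRing k]
    (L : τ → MvPolynomial σ k) (hL : ∀ t, (L t).IsHomogeneous 1) (f : MvPolynomial τ k) (i : ℕ) :
    homogeneousComponent i (aeval L f) = aeval L (homogeneousComponent i f) := by
  have h (j : ℕ) : aeval L (homogeneousComponent j f) ∈ homogeneousSubmodule σ k j := by
    have := (homogeneousComponent_isHomogeneous j f).eval₂ C L (fun r => isHomogeneous_C _ r) hL
    rwa [one_mul] at this
  conv_lhs => rw [← f.sum_homogeneousComponent, map_sum, map_sum]
  rw [Finset.sum_congr rfl fun j _ => homogeneousComponent_of_mem (h j)]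
  rw [Finset.sum_ite_eq]
  split_ifs with hi
  · rfl
  · rw [homogeneousComponent_eq_zero, map_zero]
    simpa [Nat.lt_succ_iff] using hi

theorem isHomogeneous_of_aeval_mem_iff_dvd {n : ℕ} {k : Type u} [Field k]
    (P : HomogeneousIdeal (homogeneousSubmodule (Fin (n + 1)) k)) {τ : Type*}
    (L : τ → MvPolynomial (Fin (n + 1)) k) (hL : ∀ t, (L t).IsHomogeneous 1)
    (G : MvPolynomial τ k) (hG : ∀ f, aeval L f ∈ P.toIdeal ↔ G ∣ f) :
    G.IsHomogeneous G.totalDegree := by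
  refine isHomogeneous_of_span_singleton G fun i => ?_
  rw [Ideal.mem_span_singleton, ← hG, ← homogeneousComponent_aeval L hL]
  exact homogeneousComponent_mem_of_mem P.isHomogeneous ((hG G).2 dvd_rfl) _

/-- If the preimage of a homogeneous ideal `P` under a map of polynomial rings given by linear forms
is principal, generated by `G`, then the Hilbert function of `P` is at least the one of `G`. -/
theorem multichoose_le_hilbertFunction_add {n : ℕ} {k : Type u} [Field k]
    (P : HomogeneousIdeal (homogeneousSubmodule (Fin (n + 1)) k)) {τ : Type*} [Fintype τ]
    (L : τ → MvPolynomial (Fin (n + 1)) k) (hL : ∀ t, (L t).IsHomogeneous 1)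
    (G : MvPolynomial τ k) (hG : ∀ f, aeval L f ∈ P.toIdeal ↔ G ∣ f) (m : ℕ) :
    (Fintype.card τ).multichoose (m + G.totalDegree) ≤
      hilbertFunction P (m + G.totalDegree) + (Fintype.card τ).multichoose m := by
  have hGh := isHomogeneous_of_aeval_mem_iff_dvd P L hL G hG
  set e := G.totalDegree
  let V := homogeneousSubmodule (Fin (n + 1)) k (m + e)
  let N : Submodule k V := (P.toIdeal.restrictScalars k).comap V.subtype
  have hLm (f : MvPolynomial τ k) (hf : f ∈ homogeneousSubmodule τ k (m + e)) :
      (aeval L).toLinearMap f ∈ V := by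
    have := IsHomogeneous.eval₂ (φ := f) hf C L (fun r => isHomogeneous_C _ r) hL
    rwa [one_mul] at this
  let ψ : homogeneousSubmodule τ k (m + e) →ₗ[k] V ⧸ N :=
    N.mkQ ∘ₗ (aeval L).toLinearMap.restrict hLm
  have hmul (f : MvPolynomial τ k) (hf : f ∈ homogeneousSubmodule τ k m) :
      LinearMap.mulLeft k G f ∈ homogeneousSubmodule τ k (m + e) := by
    rw [add_comm]
    exact hGh.mul hf
  let μ : homogeneousSubmodule τ k m →ₗ[k] homogeneousSubmodule τ k (m + e) :=
    (LinearMap.mulLeft k G).restrict hmul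
  have hfin (j : ℕ) : Module.Finite k (homogeneousSubmodule τ k j) :=
    Module.Finite.iff_fg.mpr (homogeneousSubmodule_fg _ _ _)
  have : Module.Finite k V := Module.Finite.iff_fg.mpr (homogeneousSubmodule_fg _ _ _)
  have hker : LinearMap.ker ψ ≤ LinearMap.range μ := by
    rintro ⟨f, hf⟩ h
    have h1 : aeval L f ∈ P.toIdeal := (Submodule.Quotient.mk_eq_zero N).1 h
    obtain ⟨g, rfl⟩ := (hG f).1 h1
    -- only the component of degree `m` of `g` contributes
    refine ⟨DirectSum.decompose (homogeneousSubmodule τ k) g m, Subtype.ext ?_⟩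
    have h2 := DirectSum.coe_decompose_mul_add_of_left_mem (𝒜 := homogeneousSubmodule τ k)
      (j := m) (b := g) hGh
    rw [add_comm, DirectSum.decompose_of_mem_same _ hf] at h2
    exact h2.symm
  have h1 := LinearMap.finrank_range_add_finrank_ker ψ
  have h2 := Submodule.finrank_le (LinearMap.range ψ)
  have h3 := (Submodule.finrank_mono hker).trans (LinearMap.finrank_range_le μ)
  rw [finrank_homogeneousSubmodule] at h1 h3
  change _ ≤ hilbertFunction P (m + e) at h2
  omega

theorem Nat.multichoose_add_mul_le (r m e : ℕ) :
    (r + 2).multichoose m + e * (r + 1).multichoose m ≤ (r + 2).multichoose (m + e) := by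
  have hmono : Monotone fun j => (r + 1).multichoose j := by
    refine monotone_nat_of_le_succ fun j => ?_
    rw [Nat.multichoose_succ_succ]
    exact Nat.le_add_left _ _
  induction e with
  | zero => simp
  | succ e ih =>
    have h1 := Nat.multichoose_succ_succ (r + 1) (m + e)
    have h2 : (r + 1).multichoose m ≤ (r + 1).multichoose (m + e + 1) :=
      hmono (show m ≤ m + e + 1 by omega)
    rw [← add_assoc m e 1, add_mul, one_mul]
    change (r + 2).multichoose (m + e + 1) = _ + (r + 2).multichoose (m + e) at h1
    omega

theorem Nat.pow_le_factorial_mul_multichoose (d m : ℕ) :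
    m ^ d ≤ d.factorial * (d + 1).multichoose m := by
  rw [Nat.multichoose_eq, show d + 1 + m - 1 = m + d by omega, Nat.choose_symm_add,
    ← Nat.ascFactorial_eq_factorial_mul_choose]
  exact (Nat.pow_le_pow_left (Nat.le_succ m) d).trans (Nat.pow_succ_le_ascFactorial (m + 1) d)

open Filter in
theorem Polynomial.leadingCoeff_nonneg_of_eventually_nonneg (p : Polynomial ℚ)
    (h : ∀ᶠ m : ℕ in atTop, 0 ≤ p.eval (m : ℚ)) : 0 ≤ p.leadingCoeff := by
  by_contra! hlt
  rcases Nat.eq_zero_or_pos p.natDegree with h0 | h0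
  · obtain ⟨m, hm⟩ := h.exists
    rw [Polynomial.eq_C_of_natDegree_eq_zero h0, Polynomial.eval_C] at hm
    rw [Polynomial.leadingCoeff, h0] at hlt
    exact absurd hm (not_le.2 hlt)
  · have := (p.tendsto_atBot_of_leadingCoeff_nonpos (Polynomial.natDegree_pos_iff_degree_pos.1 h0)
      hlt.le).comp (tendsto_natCast_atTop_atTop (R := ℚ))
    obtain ⟨m, hm1, hm2⟩ := (h.and (this.eventually (eventually_lt_atBot 0))).exists
    exact absurd hm1 (not_le.2 hm2)

open Filter in
/-- Asymptotic bounds for the Hilbert function bound the degree from below. -/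
theorem le_factorial_mul_leadingCoeff_hilbertPolynomial {n : ℕ} {k : Type u} [Field k]
    (P : HomogeneousIdeal (homogeneousSubmodule (Fin (n + 1)) k)) (d e C : ℕ) (he : 0 < e)
    (hle : ∀ m, hilbertFunction P m ≤ C * (m + 1) ^ d)
    (hge : ∀ m, e * m ^ d ≤ d.factorial * hilbertFunction P (m + e)) :
    (e : ℚ) ≤ (hilbertPolynomial P).natDegree.factorial * (hilbertPolynomial P).leadingCoeff := by
  set p := hilbertPolynomial P with hp
  have hev := (hilbertPolynomial_eq_iff P p).1 hp.symm
  have hdeg : p.natDegree ≤ d := by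
    by_contra! hlt
    have h1 : 0 ≤ p.leadingCoeff := p.leadingCoeff_nonneg_of_eventually_nonneg <| by
      filter_upwards [hev] with m hm
      rw [← hm]; positivity
    have h2 := Polynomial.leadingCoeff_nonneg_of_eventually_nonneg
      (Polynomial.C (C : ℚ) * (Polynomial.X + Polynomial.C 1) ^ d - p) <| by
        filter_upwards [hev] with m hm
        have : (hilbertFunction P m : ℚ) ≤ C * (m + 1) ^ d := by exact_mod_cast hle m
        simpa [← hm] using this
    have hq : (Polynomial.C (C : ℚ) * (Polynomial.X + Polynomial.C 1) ^ d).natDegree <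
        p.natDegree := by
      refine lt_of_le_of_lt ((Polynomial.natDegree_C_mul_le _ _).trans ?_) hlt
      rw [Polynomial.natDegree_pow, Polynomial.natDegree_X_add_C, mul_one]
    rw [Polynomial.leadingCoeff_sub_of_degree_lt' (Polynomial.degree_lt_degree hq)] at h2
    have h0 : p.leadingCoeff = 0 := by linarith
    rw [Polynomial.leadingCoeff_eq_zero] at h0
    simp [h0] at hlt
  have hcoeff : (e : ℚ) ≤ d.factorial * p.coeff d := by
    set q := Polynomial.C (d.factorial : ℚ) * p -
      Polynomial.C (e : ℚ) * (Polynomial.X - Polynomial.C (e : ℚ)) ^ d with hq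
    have hqc : q.coeff d = d.factorial * p.coeff d - e := by
      have : ((Polynomial.X - Polynomial.C (e : ℚ)) ^ d).coeff d = 1 := by
        have := ((Polynomial.monic_X_sub_C (e : ℚ)).pow d).coeff_natDegree
        rwa [Polynomial.natDegree_pow, Polynomial.natDegree_X_sub_C, mul_one] at this
      rw [hq, Polynomial.coeff_sub, Polynomial.coeff_C_mul, Polynomial.coeff_C_mul, this, mul_one]
    have hqd : q.natDegree ≤ d := by
      refine (Polynomial.natDegree_sub_le _ _).trans (max_le
        ((Polynomial.natDegree_C_mul_le _ _).trans hdeg)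
        ((Polynomial.natDegree_C_mul_le _ _).trans ?_))
      rw [Polynomial.natDegree_pow, Polynomial.natDegree_X_sub_C, mul_one]
    have hq0 := q.leadingCoeff_nonneg_of_eventually_nonneg <| by
      filter_upwards [hev, eventually_ge_atTop e] with m hm hme
      have := hge (m - e)
      rw [Nat.sub_add_cancel hme] at this
      have h' : (e : ℚ) * ((m - e : ℕ) : ℚ) ^ d ≤ d.factorial * hilbertFunction P m := by
        exact_mod_cast this
      rw [Nat.cast_sub hme, hm] at h'
      simpa [hq] using h'
    rcases hqd.lt_or_eq with h | h
    · rw [Polynomial.coeff_eq_zero_of_natDegree_lt h] at hqc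
      linarith
    · rw [Polynomial.leadingCoeff, h, hqc] at hq0
      linarith
  have hd : p.natDegree = d := by
    refine le_antisymm hdeg (Polynomial.le_natDegree_of_ne_zero fun h => ?_)
    rw [h, mul_zero] at hcoeff
    exact absurd hcoeff (not_le.2 (by exact_mod_cast he))
  rw [Polynomial.leadingCoeff, hd]
  exact hcoeff

/-- Gauss' lemma for minimal polynomials: over a unique factorization domain `B` with fraction field
`K`, the polynomials vanishing at an algebraic element are the multiples of a primitive multiple of
the minimal polynomial over `K`. -/
theorem exists_primitive_minpoly (B K : Type*) {L : Type*} [CommRing B] [IsDomain B]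
    [UniqueFactorizationMonoid B] [Field K] [Field L] [Algebra B K] [Algebra K L] [Algebra B L]
    [IsScalarTower B K L] [IsFractionRing B K] (z : L) (hz : IsIntegral K z) :
    ∃ (G : Polynomial B) (c : K), c ≠ 0 ∧
      G.map (algebraMap B K) = Polynomial.C c * minpoly K z ∧
      ∀ f : Polynomial B, Polynomial.aeval z f = 0 ↔ G ∣ f := by
  classical
  let : NormalizedGCDMonoid B := Classical.choice inferInstance
  let G₀ := IsLocalization.integerNormalization (nonZeroDivisors B) (minpoly K z)
  obtain ⟨b, hb, hG₀⟩ := IsLocalization.integerNormalization_spec (nonZeroDivisors B) (minpoly K z)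
  have hinj := IsFractionRing.injective B K
  have hb0 : algebraMap B K b ≠ 0 := by
    rw [Ne, map_eq_zero_iff _ hinj]
    exact nonZeroDivisors.ne_zero hb
  have hG₀' : G₀.map (algebraMap B K) = Polynomial.C (algebraMap B K b) * minpoly K z := by
    rw [hG₀, ← algebraMap_smul K b, Polynomial.smul_eq_C_mul]
  have hcont : algebraMap B K G₀.content ≠ 0 := by
    rw [Ne, map_eq_zero_iff _ hinj, Polynomial.content_eq_zero_iff]
    rintro h
    rw [h, Polynomial.map_zero] at hG₀'
    exact mul_ne_zero (Polynomial.C_ne_zero.2 hb0) (minpoly.ne_zero hz) hG₀'.symm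
  have hmap : G₀.primPart.map (algebraMap B K) =
      Polynomial.C ((algebraMap B K G₀.content)⁻¹ * algebraMap B K b) * minpoly K z := by
    rw [G₀.eq_C_content_mul_primPart, Polynomial.map_mul, Polynomial.map_C] at hG₀'
    rw [Polynomial.C_mul, mul_assoc, ← hG₀', ← mul_assoc, ← Polynomial.C_mul,
      inv_mul_cancel₀ hcont, Polynomial.C_1, one_mul]
  refine ⟨G₀.primPart, _, mul_ne_zero (inv_ne_zero hcont) hb0, hmap, fun f => ?_⟩
  rw [G₀.isPrimitive_primPart.dvd_iff_fraction_map_dvd_fraction_map K, hmap,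
    (Polynomial.isUnit_C.2 (mul_ne_zero (inv_ne_zero hcont) hb0).isUnit).mul_left_dvd,
    minpoly.dvd_iff, Polynomial.aeval_map_algebraMap]

end HilbertLowerBound

/-! ### Linear projections of a projective variety -/

section LinearProjections

open MvPolynomial

variable {n : ℕ} {k L : Type u} [Field k] [Field L] [Algebra k L]

/-- The hypersurface to which a homogeneous prime projects by the variables in a transcendence basis
and one further linear form has degree at most the degree of the prime. -/
theorem exists_primitive_minpoly_totalDegree_le
    (P : HomogeneousIdeal (homogeneousSubmodule (Fin (n + 1)) k)) (a : Fin (n + 1) → L)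
    (hP : ∀ f, f ∈ P.toIdeal ↔ aeval a f = 0) (s : Set (Fin (n + 1)))
    (hs : IsTranscendenceBasis k fun i : s => a i) (hne : s.Nonempty)
    (K : Type*) [Field K] [Algebra (MvPolynomial s k) K] [IsFractionRing (MvPolynomial s k) K]
    [Algebra K L] [Algebra (MvPolynomial s k) L] [IsScalarTower (MvPolynomial s k) K L]
    (hBL : ∀ b : MvPolynomial s k, algebraMap _ L b = aeval (fun i : s => a i) b)
    (ℓ : MvPolynomial (Fin (n + 1)) k) (hℓ : ℓ.IsHomogeneous 1) (hz : IsIntegral K (aeval a ℓ))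
    {δ : ℕ} (hδ : (hilbertPolynomial P).natDegree.factorial * (hilbertPolynomial P).leadingCoeff ≤
      δ) :
    ∃ (G : Polynomial (MvPolynomial s k)) (c : K), c ≠ 0 ∧
      G.map (algebraMap _ K) = Polynomial.C c * minpoly K (aeval a ℓ) ∧
      G.eval₂ (rename (↑)).toRingHom ℓ ∈ P.toIdeal ∧
      (G.eval₂ (rename (↑)).toRingHom ℓ).totalDegree ≤ δ := by
  classical
  obtain ⟨G, c, hc, hGc, hG⟩ := exists_primitive_minpoly (MvPolynomial s k) K (aeval a ℓ) hz
  refine ⟨G, c, hc, hGc, ?_⟩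
  let θ : Polynomial (MvPolynomial s k) →+* MvPolynomial (Fin (n + 1)) k :=
    Polynomial.eval₂RingHom (rename (↑)).toRingHom ℓ
  let lin : Option s → MvPolynomial (Fin (n + 1)) k := fun t => t.elim ℓ fun i => X i.1
  have hlin (t) : (lin t).IsHomogeneous 1 := by
    cases t with
    | none => exact hℓ
    | some i => exact isHomogeneous_X _ _
  have hθ (f : MvPolynomial (Option s) k) : aeval lin f = θ (optionEquivLeft k s f) := by
    induction f using MvPolynomial.induction_on with
    | C r => simp [θ, algebraMap_eq]
    | add p q hp hq => simp only [map_add, hp, hq]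
    | mul_X p i hp =>
      rw [map_mul, map_mul, map_mul, hp]
      congr 1
      cases i <;> simp [θ, lin]
  have haθ (f : Polynomial (MvPolynomial s k)) :
      aeval a (θ f) = Polynomial.aeval (aeval a ℓ) f := by
    induction f using Polynomial.induction_on' with
    | add p q hp hq => simp only [map_add, hp, hq]
    | monomial j b =>
      simp [θ, Polynomial.aeval_monomial, hBL, aeval_rename, Function.comp_def]
  let G' := (optionEquivLeft k s).symm G
  have hG' (f) : aeval lin f ∈ P.toIdeal ↔ G' ∣ f := by
    rw [hP, hθ, haθ, hG, ← map_dvd_iff (optionEquivLeft k s) (a := G')]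
    simp [G']
  have hGG : aeval lin G' = θ G := by rw [hθ]; simp [G']
  set e := G'.totalDegree with he
  have hmem : θ G ∈ P.toIdeal := by rw [← hGG, hG']
  have hdeg : (θ G).totalDegree ≤ e := by
    have := (isHomogeneous_of_aeval_mem_iff_dvd P lin hlin G' hG').eval₂ C lin
      (fun r => isHomogeneous_C _ r) hlin
    rw [one_mul] at this
    rw [← hGG]
    exact this.totalDegree_le
  refine ⟨hmem, hdeg.trans ?_⟩
  rcases Nat.eq_zero_or_pos e with h0 | hpos
  · rw [h0]; exact Nat.zero_le _
  obtain ⟨d, hd⟩ : ∃ d, Fintype.card s = d + 1 := by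
    have := hne.to_subtype
    exact Nat.exists_eq_succ_of_ne_zero Fintype.card_ne_zero
  obtain ⟨C, hC⟩ := exists_hilbertFunction_le P (d + 1) d.succ_pos fun I hI => by
    have hnot : ¬ AlgebraicIndependent k fun i : I => a i := by
      intro hind
      have h1 := hind.lift_cardinalMk_le_trdeg
      rw [← hs.lift_cardinalMk_eq_trdeg] at h1
      simp only [Cardinal.lift_natCast, Cardinal.mk_fintype, Nat.cast_le, Fintype.card_coe] at h1
      omega
    rw [algebraicIndependent_iff] at hnot
    push Not at hnot
    obtain ⟨g, hg, hg0⟩ := hnot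
    exact ⟨g, hg0, by rw [hP, aeval_rename]; exact hg⟩
  have := le_factorial_mul_leadingCoeff_hilbertPolynomial P d e C hpos hC fun m => by
    have h1 := multichoose_le_hilbertFunction_add P lin hlin G' hG' m
    rw [← he, Fintype.card_option, hd] at h1
    have h2 := Nat.multichoose_add_mul_le d m e
    have h3 := Nat.pow_le_factorial_mul_multichoose d m
    calc e * m ^ d ≤ e * (d.factorial * (d + 1).multichoose m) := Nat.mul_le_mul_left _ h3
      _ = d.factorial * (e * (d + 1).multichoose m) := by ring
      _ ≤ d.factorial * hilbertFunction P (m + e) := Nat.mul_le_mul_left _ (by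
        change (d + 2).multichoose (m + e) ≤ _ + (d + 2).multichoose m at h1
        omega)
  exact_mod_cast this.trans hδ

theorem splitVars_eval₂ {ι R : Type*} [CommRing R] (I : Set ι) (G : Polynomial (MvPolynomial I R))
    (ℓ : MvPolynomial ι R) : splitVars I R (G.eval₂ (rename (↑)).toRingHom ℓ) =
      Polynomial.aeval (splitVars I R ℓ) G := by
  induction G using Polynomial.induction_on' with
  | add p q hp hq => rw [Polynomial.eval₂_add, map_add, map_add, hp, hq]
  | monomial j b =>
    rw [Polynomial.eval₂_monomial, map_mul, map_pow, Polynomial.aeval_monomial, algebraMap_eq]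
    exact congrArg (· * _) (splitVars_rename I R b)

/-- The equations of a projective variety over the generic point of a coordinate subspace given by a
separating transcendence basis come from linear projections to hypersurfaces. -/
theorem exists_mul_mem_span_of_isSeparable [Infinite k]
    (P : HomogeneousIdeal (homogeneousSubmodule (Fin (n + 1)) k)) (a : Fin (n + 1) → L)
    (hP : ∀ f, f ∈ P.toIdeal ↔ aeval a f = 0) (s : Set (Fin (n + 1)))
    (hs : IsTranscendenceBasis k fun i : s => a i) (hne : s.Nonempty)
    (K : Type*) [Field K] [Algebra (MvPolynomial s k) K] [IsFractionRing (MvPolynomial s k) K]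
    [Algebra K L] [Algebra (MvPolynomial s k) L] [IsScalarTower (MvPolynomial s k) K L]
    [Algebra k K] [IsScalarTower k (MvPolynomial s k) K] [IsScalarTower k K L]
    [FiniteDimensional K L] [Algebra.IsSeparable K L]
    (hBL : ∀ b : MvPolynomial s k, algebraMap _ L b = aeval (fun i : s => a i) b) {δ : ℕ}
    (hδ : (hilbertPolynomial P).natDegree.factorial * (hilbertPolynomial P).leadingCoeff ≤ δ) :
    ∀ f ∈ P.toIdeal, ∃ g : MvPolynomial s k, g ≠ 0 ∧
      rename (↑) g * f ∈ Ideal.span {p | p ∈ P.toIdeal ∧ p.totalDegree ≤ δ} := by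
  classical
  let B := MvPolynomial s k
  intro f hf
  let z : ↥sᶜ → L := fun j => a j
  let ℓ (l : ↥sᶜ → k) : MvPolynomial (Fin (n + 1)) k := ∑ j, l j • X j.1
  have hℓ (l) : (ℓ l).IsHomogeneous 1 :=
    (homogeneousSubmodule _ _ 1).sum_mem fun j _ =>
      (homogeneousSubmodule _ _ 1).smul_mem _ (isHomogeneous_X _ _)
  have haℓ (l) : aeval a (ℓ l) = ∑ j, l j • z j := by simp [ℓ, z]
  choose G c hc hGc hGP hGδ using fun l => exists_primitive_minpoly_totalDegree_le P a hP s hs hne K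
    hBL (ℓ l) (hℓ l) (Algebra.IsIntegral.isIntegral _) hδ
  let J : Ideal (MvPolynomial ↥sᶜ B) :=
    Ideal.span (Set.range fun l => splitVars s k ((G l).eval₂ (rename (↑)).toRingHom (ℓ l)))
  have hsplit (l) : splitVars s k ((G l).eval₂ (rename (↑)).toRingHom (ℓ l)) =
      Polynomial.aeval (∑ j, l j • X j) (G l) := by
    rw [splitVars_eval₂]
    simp only [ℓ, map_sum, map_smul, splitVars_X_compl]
  have hJ : projectionIdeal k K z ≤ J.map (MvPolynomial.map (algebraMap B K)) := by
    refine Ideal.span_le.2 ?_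
    rintro _ ⟨l, rfl⟩
    have h1 := Ideal.mem_map_of_mem (MvPolynomial.map (algebraMap B K))
      (Ideal.subset_span ⟨l, rfl⟩ : splitVars s k _ ∈ J)
    have h2 : MvPolynomial.map (algebraMap B K)
        (splitVars s k ((G l).eval₂ (rename (↑)).toRingHom (ℓ l))) =
        C (c l) * Polynomial.aeval (∑ j, l j • X j) (minpoly K (∑ j, l j • z j)) := by
      rw [hsplit, Polynomial.aeval_def, Polynomial.hom_eval₂, ← haℓ]
      have h3 := congrArg (Polynomial.aeval (∑ j, l j • X j : MvPolynomial ↥sᶜ K)) (hGc l)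
      rw [map_mul, Polynomial.aeval_C, Polynomial.aeval_def, Polynomial.eval₂_map] at h3
      refine Eq.trans ?_ h3
      congr 1
      · exact RingHom.ext fun b => map_C _ _
      · rw [map_sum]
        refine Finset.sum_congr rfl fun j _ => ?_
        rw [← algebraMap_smul B, smul_eq_C_mul, map_mul, map_C, map_X, ← smul_eq_C_mul,
          ← IsScalarTower.algebraMap_apply, algebraMap_smul]
    rw [h2] at h1
    exact (Ideal.unit_mul_mem_iff_mem _ ((hc l).isUnit.map C)).1 h1
  have hfK : MvPolynomial.map (algebraMap B K) (splitVars s k f) ∈ projectionIdeal k K z := by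
    apply mem_projectionIdeal
    have h1 (f : MvPolynomial (Fin (n + 1)) k) :
        aeval z (MvPolynomial.map (algebraMap B K) (splitVars s k f)) = aeval a f := by
      rw [aeval_map_algebraMap]
      induction f using MvPolynomial.induction_on with
      | C r =>
        have := splitVars_rename s k (C r)
        rw [rename_C] at this
        rw [this, aeval_C, hBL, aeval_C, aeval_C]
      | add p q hp hq => simp only [map_add, hp, hq]
      | mul_X p i hp =>
        rw [map_mul, map_mul, map_mul, hp, aeval_X]
        congr 1
        by_cases hi : i ∈ s
        · have := splitVars_rename s k (X ⟨i, hi⟩)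
          rw [rename_X] at this
          rw [this, aeval_C, hBL, aeval_X]
        · have := splitVars_X_compl s k ⟨i, hi⟩
          dsimp only at this
          rw [this, aeval_X]
    rw [h1, ← hP]
    exact hf
  obtain ⟨g, hg, f₀, hf₀, h⟩ := exists_mem_of_mem_map_of_isLocalization (nonZeroDivisors B) J
    (hJ hfK)
  refine ⟨g, nonZeroDivisors.ne_zero hg, ?_⟩
  have hf₀' : f₀ = splitVars s k (rename (↑) g * f) := by
    apply MvPolynomial.map_injective _ (IsFractionRing.injective B K)
    rw [h, map_mul, map_mul, splitVars_rename, map_C]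
  rw [hf₀'] at hf₀
  have : J ≤ (Ideal.span {p | p ∈ P.toIdeal ∧ p.totalDegree ≤ δ}).map (splitVars s k) := by
    refine Ideal.span_le.2 ?_
    rintro _ ⟨l, rfl⟩
    exact Ideal.mem_map_of_mem _ (Ideal.subset_span ⟨hGP l, hGδ l⟩)
  have h2 := this hf₀
  rw [Ideal.mem_map_of_equiv] at h2
  obtain ⟨x, hx, hxe⟩ := h2
  rwa [← (splitVars s k).injective hxe]

/-- The equations of a projective variety over the generic point of a coordinate subspace, for the
generic point `a` of the affine cone over the variety. -/
theorem exists_mul_mem_span_totalDegree_le_of_generic [IsAlgClosed k]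
    (P : HomogeneousIdeal (homogeneousSubmodule (Fin (n + 1)) k)) (a : Fin (n + 1) → L)
    (hP : ∀ f, f ∈ P.toIdeal ↔ aeval a f = 0)
    (ha : IntermediateField.adjoin k (Set.range a) = ⊤)
    (hX : ∃ i, (X i : MvPolynomial (Fin (n + 1)) k) ∉ P.toIdeal) {δ : ℕ}
    (hδ : (hilbertPolynomial P).natDegree.factorial * (hilbertPolynomial P).leadingCoeff ≤ δ) :
    ∃ s : Set (Fin (n + 1)), (∀ g : MvPolynomial s k, rename (↑) g ∈ P.toIdeal → g = 0) ∧
      ∀ f ∈ P.toIdeal, ∃ g : MvPolynomial s k, g ≠ 0 ∧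
        rename (↑) g * f ∈ Ideal.span {p | p ∈ P.toIdeal ∧ p.totalDegree ≤ δ} := by
  classical
  obtain ⟨s, hs, hsep⟩ := exists_set_isTranscendenceBasis_and_isSeparable a ha
  rw [Set.image_eq_range] at hsep
  have hne : s.Nonempty := by
    by_contra hemp
    rw [Set.not_nonempty_iff_eq_empty] at hemp
    subst hemp
    have halg : Algebra.IsAlgebraic k L := hs.isEmpty_iff_isAlgebraic.1 inferInstance
    obtain ⟨i, hi⟩ := hX
    obtain ⟨c, hc⟩ := (IsAlgClosed.algebraMap_bijective_of_isIntegral (k := k) (K := L)).2 (a i)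
    apply hi
    have h1 : X i - C c ∈ P.toIdeal := by
      rw [hP, map_sub, aeval_X, aeval_C, hc, sub_self]
    have h2 := homogeneousComponent_mem_of_mem P.isHomogeneous h1 1
    rwa [map_sub, homogeneousComponent_eq_self (isHomogeneous_X k i), homogeneousComponent_of_mem
      (isHomogeneous_C _ c), if_neg one_ne_zero, sub_zero] at h2
  refine ⟨s, fun g hg => ?_, ?_⟩
  · rw [hP, aeval_rename] at hg
    exact (algebraicIndependent_iff.1 hs.1) g hg
  let K := IntermediateField.adjoin k (Set.range fun i : s => a i)
  let B := MvPolynomial s k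
  let eK := hs.1.aevalEquivField
  let : Algebra B K := ((eK : FractionRing B →+* K).comp (algebraMap B (FractionRing B))).toAlgebra
  let : Algebra B L := (aeval fun i : s => a i).toRingHom.toAlgebra
  have hBL (b : B) : algebraMap B L b = aeval (fun i : s => a i) b := rfl
  have : IsScalarTower B K L := IsScalarTower.of_algebraMap_eq fun b =>
    (hs.1.aevalEquivField_algebraMap_apply_coe b).symm
  have : IsFractionRing B K :=
    IsLocalization.isLocalization_of_algEquiv (S := FractionRing B) (nonZeroDivisors B)
      (AlgEquiv.ofRingEquiv (f := (eK : FractionRing B ≃+* K)) fun b => rfl)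
  have : IsScalarTower k B K := IsScalarTower.of_algebraMap_eq fun c =>
    (eK.commutes c).symm
  have : Algebra.IsSeparable K L := hsep
  have hKL : IntermediateField.adjoin K (Set.range a) = ⊤ := by
    rw [← (IntermediateField.restrictScalars_injective k).eq_iff,
      IntermediateField.restrictScalars_top, eq_top_iff, ← ha, IntermediateField.adjoin_le_iff]
    exact IntermediateField.subset_adjoin K _
  have hfd : FiniteDimensional K L := by
    have := IntermediateField.finiteDimensional_adjoin (K := K) (S := Set.range a)
      fun x _ => Algebra.IsIntegral.isIntegral x
    rw [hKL] at this
    exact Module.Finite.equiv IntermediateField.topEquiv.toLinearEquiv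
  exact exists_mul_mem_span_of_isSeparable P a hP s hs hne K hBL hδ

/-- A homogeneous prime over an algebraically closed field is cut out, over the generic point of
some coordinate subspace, by its elements of degree at most its degree. -/
theorem exists_mul_mem_span_totalDegree_le {n : ℕ} {k : Type u} [Field k] [IsAlgClosed k]
    (P : HomogeneousIdeal (homogeneousSubmodule (Fin (n + 1)) k)) [hPp : P.toIdeal.IsPrime]
    (hX : ∃ i, (X i : MvPolynomial (Fin (n + 1)) k) ∉ P.toIdeal) {δ : ℕ}
    (hδ : (hilbertPolynomial P).natDegree.factorial * (hilbertPolynomial P).leadingCoeff ≤ δ) :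
    ∃ s : Set (Fin (n + 1)), (∀ g : MvPolynomial s k, rename (↑) g ∈ P.toIdeal → g = 0) ∧
      ∀ f ∈ P.toIdeal, ∃ g : MvPolynomial s k, g ≠ 0 ∧
        rename (↑) g * f ∈ Ideal.span {p | p ∈ P.toIdeal ∧ p.totalDegree ≤ δ} := by
  classical
  let R := MvPolynomial (Fin (n + 1)) k ⧸ P.toIdeal
  let L := FractionRing R
  let a : Fin (n + 1) → L := fun i => algebraMap R L (Ideal.Quotient.mk _ (X i))
  have haeval : aeval a = (IsScalarTower.toAlgHom k R L).comp (Ideal.Quotient.mkₐ k P.toIdeal) :=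
    MvPolynomial.algHom_ext fun i => by rw [aeval_X]; rfl
  have hP (f) : f ∈ P.toIdeal ↔ aeval a f = 0 := by
    rw [haeval, AlgHom.comp_apply, IsScalarTower.coe_toAlgHom',
      map_eq_zero_iff _ (IsFractionRing.injective R L), Ideal.Quotient.mkₐ_eq_mk,
      Ideal.Quotient.eq_zero_iff_mem]
  have hmemR (K : IntermediateField k L) (hK : ∀ i, a i ∈ K) (x : R) : algebraMap R L x ∈ K := by
    obtain ⟨f, rfl⟩ := Ideal.Quotient.mk_surjective x
    have : algebraMap R L (Ideal.Quotient.mk _ f) = aeval a f := by rw [haeval]; rfl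
    rw [this]
    induction f using MvPolynomial.induction_on with
    | C r => rw [← algebraMap_eq, AlgHom.commutes]; exact K.algebraMap_mem r
    | add p q hp hq =>
      rw [map_add]
      exact K.add_mem (hp (by rw [haeval]; rfl)) (hq (by rw [haeval]; rfl))
    | mul_X p i hp =>
      rw [map_mul, aeval_X]
      exact K.mul_mem (hp (by rw [haeval]; rfl)) (hK i)
  have ha : IntermediateField.adjoin k (Set.range a) = ⊤ := by
    rw [eq_top_iff]
    rintro x -
    obtain ⟨p, q, -, rfl⟩ := IsFractionRing.div_surjective (A := R) x
    have hi (i) : a i ∈ IntermediateField.adjoin k (Set.range a) :=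
      IntermediateField.subset_adjoin _ _ ⟨i, rfl⟩
    exact div_mem (hmemR _ hi p) (hmemR _ hi q)
  exact exists_mul_mem_span_totalDegree_le_of_generic P a hP ha hX hδ

end LinearProjections

/-! ### The universal family of ideals generated in bounded degree -/

section UniversalFamily

open MvPolynomial

/-- The exponents of total degree at most `D` of monomials in `n + 1` variables. -/
def exponentsLE (n D : ℕ) : Finset (Fin (n + 1) →₀ ℕ) :=
  (Finset.range (D + 1)).biUnion fun e => Finset.univ.finsuppAntidiag e

theorem mem_exponentsLE {n D : ℕ} {t : Fin (n + 1) →₀ ℕ} : t ∈ exponentsLE n D ↔ t.degree ≤ D := by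
  simp [exponentsLE, Finsupp.degree_eq_sum, eq_comm]

/-- The ring of coefficients of the universal family: for every exponent `t` of degree at most `D`
there is one universal form of the degree of `t`. -/
abbrev UniversalCoeff (n D : ℕ) : Type u :=
  MvPolynomial (exponentsLE n D × exponentsLE n D) (ULift.{u} ℤ)

/-- The universal form of the same degree as the exponent `t`. -/
noncomputable def universalForm (n D : ℕ) (t : exponentsLE n D) :
    MvPolynomial (Fin (n + 1)) (UniversalCoeff.{u} n D) :=
  ∑ m : exponentsLE n D, if m.1.degree = t.1.degree then monomial m.1 (X (t, m)) else 0

theorem universalForm_isHomogeneous (n D : ℕ) (t : exponentsLE n D) :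
    (universalForm.{u} n D t).IsHomogeneous t.1.degree := by
  refine IsHomogeneous.sum _ _ _ fun m _ => ?_
  split_ifs with h
  · exact isHomogeneous_monomial _ h
  · exact isHomogeneous_zero _ _ _

theorem universalForm_map {n D : ℕ} {k : Type*} [CommRing k]
    (p : exponentsLE n D → MvPolynomial (Fin (n + 1)) k)
    (hp : ∀ t, (p t).IsHomogeneous t.1.degree) (φ : UniversalCoeff.{u} n D →+* k)
    (hφ : ∀ t m, φ (X (t, m)) = (p t).coeff m) (t : exponentsLE n D) :
    map φ (universalForm.{u} n D t) = p t := by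
  classical
  ext d
  rw [universalForm, map_sum, coeff_sum]
  simp only [apply_ite (map φ), map_monomial, map_zero, hφ, apply_ite (coeff d), coeff_monomial,
    coeff_zero]
  by_cases hd : d.degree = t.1.degree
  · have hmem : d ∈ exponentsLE n D := by
      rw [mem_exponentsLE, hd]
      exact mem_exponentsLE.1 t.2
    rw [Finset.sum_eq_single ⟨d, hmem⟩]
    · simp [hd]
    · intro m _ hm
      rw [if_neg (c := m.1 = d) fun h => hm (Subtype.ext h), ite_self]
    · exact fun h => absurd (Finset.mem_univ _) h
  · rw [Finset.sum_eq_zero, (hp t).coeff_eq_zero hd]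
    intro m _
    split_ifs with h1 h2
    · exact absurd (h2 ▸ h1) hd
    · rfl
    · rfl

/-- The ideals generated by the elements of degree at most `D` of a homogeneous ideal are
specializations of the universal family. -/
theorem exists_span_universalForm {n : ℕ} {k : Type u} [Field k]
    (P : HomogeneousIdeal (homogeneousSubmodule (Fin (n + 1)) k)) (D : ℕ) :
    ∃ φ : UniversalCoeff.{u} n D →+* k,
      Ideal.span (Set.range fun t => map φ (universalForm n D t)) =
        Ideal.span {p | p ∈ P.toIdeal ∧ p.totalDegree ≤ D} := by
  classical
  let W (e : ℕ) : Submodule k (MvPolynomial (Fin (n + 1)) k) :=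
    P.toIdeal.restrictScalars k ⊓ homogeneousSubmodule (Fin (n + 1)) k e
  have hπ (e : ℕ) : ∃ π : MvPolynomial (Fin (n + 1)) k →ₗ[k] W e, π ∘ₗ (W e).subtype =
      LinearMap.id := (W e).subtype.exists_leftInverse_of_injective (W e).ker_subtype
  choose π hπ using hπ
  -- the projections of the monomials of degree `e` to the degree `e` part of `P` span that part
  let p (t : exponentsLE n D) : MvPolynomial (Fin (n + 1)) k := π t.1.degree (monomial t.1 1)
  have hp (t) : p t ∈ W t.1.degree := (π t.1.degree (monomial t.1 1)).2
  let φ : UniversalCoeff.{u} n D →+* k :=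
    eval₂Hom ((Int.castRingHom k).comp ULift.ringEquiv.toRingHom) fun x => (p x.1).coeff x.2
  have hφ (t) : map φ (universalForm n D t) = p t :=
    universalForm_map p (fun t => (hp t).2) φ (fun t m => eval₂Hom_X' _ _ _) t
  refine ⟨φ, ?_⟩
  simp only [hφ]
  apply le_antisymm
  · refine Ideal.span_le.2 ?_
    rintro _ ⟨t, rfl⟩
    exact Ideal.subset_span ⟨(hp t).1,
      (IsHomogeneous.totalDegree_le (hp t).2).trans (mem_exponentsLE.1 t.2)⟩
  · refine Ideal.span_le.2 ?_
    rintro f ⟨hfP, hfD⟩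
    rw [SetLike.mem_coe, ← f.sum_homogeneousComponent]
    refine Ideal.sum_mem _ fun e he => ?_
    have heD : e ≤ D := by have := Finset.mem_range.1 he; omega
    set q := homogeneousComponent e f with hq
    have hqW : q ∈ W e := ⟨homogeneousComponent_mem_of_mem P.isHomogeneous hfP e,
      homogeneousComponent_mem e f⟩
    have h1 : (π e q : MvPolynomial (Fin (n + 1)) k) = q :=
      congrArg Subtype.val (LinearMap.congr_fun (hπ e) ⟨q, hqW⟩)
    have h2 : ((W e).subtype ∘ₗ π e) (∑ m ∈ q.support, monomial m (q.coeff m)) = q := by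
      rw [q.support_sum_monomial_coeff]; exact h1
    rw [← h2, map_sum]
    refine Ideal.sum_mem _ fun m hm => ?_
    have hme : m.degree = e := by
      rw [Finsupp.degree_eq_weight_one]
      exact hqW.2 (mem_support_iff.1 hm)
    have h3 : monomial m (q.coeff m) = q.coeff m • monomial m (1 : k) := by
      rw [smul_monomial, smul_eq_mul, mul_one]
    rw [h3, map_smul, smul_eq_C_mul]
    refine Ideal.mul_mem_left _ _ (Ideal.subset_span ⟨⟨m, mem_exponentsLE.2 (hme ▸ heD)⟩, ?_⟩)
    subst hme
    rfl

/-- Homogeneous primes of bounded degree over algebraically closed fields are generated in bounded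
degree. -/
theorem exists_bound_eq_span_totalDegree_le (n δ : ℕ) : ∃ D : ℕ, ∀ {k : Type u} [Field k]
    [IsAlgClosed k] (P : HomogeneousIdeal (homogeneousSubmodule (Fin (n + 1)) k)),
    P.toIdeal.IsPrime → (∃ i, (X i : MvPolynomial (Fin (n + 1)) k) ∉ P.toIdeal) →
    (hilbertPolynomial P).natDegree.factorial * (hilbertPolynomial P).leadingCoeff ≤ δ →
    P.toIdeal = Ideal.span {p | p ∈ P.toIdeal ∧ p.totalDegree ≤ D} := by
  classical
  have : IsNoetherianRing (ULift.{u} ℤ) := isNoetherianRing_of_ringEquiv ℤ ULift.ringEquiv.symm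
  let J : Ideal (MvPolynomial (Fin (n + 1)) (UniversalCoeff.{u} n δ)) :=
    Ideal.span (Set.range (universalForm n δ))
  choose D hD using fun s : Set (Fin (n + 1)) => exists_degree_bound_contraction.{u} J s
  refine ⟨∑ s, D s, fun {k} _ _ P hP hX hδ => le_antisymm (fun f hf => ?_)
    (Ideal.span_le.2 fun p hp => hp.1)⟩
  obtain ⟨s, hs, hsf⟩ := exists_mul_mem_span_totalDegree_le P hX hδ
  obtain ⟨φ, hφ⟩ := exists_span_universalForm P δ
  have hJ : J.map (MvPolynomial.map φ) = Ideal.span {p | p ∈ P.toIdeal ∧ p.totalDegree ≤ δ} := by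
    rw [← hφ, Ideal.map_span, ← Set.range_comp]
    rfl
  obtain ⟨g, hg, hgf⟩ := hsf f hf
  rw [← hJ] at hgf
  refine Ideal.span_mono ?_ (hD s φ f g hg hgf)
  rintro p ⟨hpD, g, hg, hgp⟩
  refine ⟨?_, hpD.trans (Finset.single_le_sum (fun _ _ => Nat.zero_le _) (Finset.mem_univ s))⟩
  rw [hJ] at hgp
  refine (hP.mem_or_mem (Ideal.span_le.2 (fun p hp => hp.1) hgp)).resolve_left fun h => ?_
  exact hg (hs g h)

end UniversalFamily

/-! ### Coordinate functions on the standard charts of projective space -/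

section Ratio

open MvPolynomial

theorem MvPolynomial.IsHomogeneous.eval₂_mul {σ R T : Type*} [CommRing R] [CommRing T]
    {F : MvPolynomial σ R} {e : ℕ} (hF : F.IsHomogeneous e) (c : R →+* T) (y : σ → T) (v : T) :
    MvPolynomial.eval₂ c (fun j => v * y j) F = v ^ e * MvPolynomial.eval₂ c y F := by
  rw [MvPolynomial.eval₂_eq, MvPolynomial.eval₂_eq, Finset.mul_sum]
  refine Finset.sum_congr rfl fun d hd => ?_
  have : d.degree = e := by
    rw [Finsupp.degree_eq_weight_one]
    exact hF (mem_support_iff.1 hd)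
  simp only [mul_pow, Finset.prod_mul_distrib, Finset.prod_pow_eq_pow_sum]
  rw [← this, Finsupp.degree_apply]
  ring

namespace ProjSpace

variable {n : ℕ}

theorem ratio_self (i : Fin (n + 1)) : ratio.{u} i i = 1 := by
  have : HomogeneousLocalization.Away.mk (homogeneousSubmodule (Fin (n + 1)) (ULift.{u} ℤ))
      (X_mem_homogeneousSubmodule (ULift.{u} ℤ) i) 1 (X i)
        ((one_smul ℕ 1).symm ▸ X_mem_homogeneousSubmodule _ i) = 1 := by
    apply HomogeneousLocalization.val_injective
    rw [HomogeneousLocalization.Away.val_mk, HomogeneousLocalization.val_one]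
    simp
  rw [ratio, this]
  exact map_one _

theorem ratio_val (i j : Fin (n + 1)) (p : chart.{u} (n := n) i) :
    HomogeneousLocalization.val ((ratio.{u} i j).1 p) =
      Localization.mk (X j) ⟨X i, p.2⟩ := by
  refine (ProjectiveSpectrum.Proj.awayToSection_apply _ _ _ _).trans ?_
  rw [HomogeneousLocalization.Away.val_mk, Localization.mk_eq_mk', IsLocalization.map_mk',
    Localization.mk_eq_mk']
  simp

theorem ratio_mul_ratio (i j l : Fin (n + 1)) :
    (ProjZ.{u} n).presheaf.map (homOfLE inf_le_left : chart i ⊓ chart j ⟶ chart i).op (ratio i l) =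
      (ProjZ.{u} n).presheaf.map (homOfLE inf_le_left : chart i ⊓ chart j ⟶ chart i).op (ratio i j) *
      (ProjZ.{u} n).presheaf.map (homOfLE inf_le_right : chart i ⊓ chart j ⟶ chart j).op
        (ratio j l) := by
  apply Subtype.ext
  funext p
  apply HomogeneousLocalization.val_injective
  refine Eq.trans ?_ (HomogeneousLocalization.val_mul _ _).symm
  refine (ratio_val i l ⟨p.1, p.2.1⟩).trans ?_
  refine Eq.trans ?_ (congrArg₂ (· * ·) (ratio_val i j ⟨p.1, p.2.1⟩)
    (ratio_val j l ⟨p.1, p.2.2⟩)).symm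
  dsimp only
  rw [Localization.mk_mul, Localization.mk_eq_mk_iff, Localization.r_iff_exists]
  exact ⟨1, by simp; ring⟩

theorem basicOpen_ratio_le (i j : Fin (n + 1)) :
    (ProjZ.{u} n).basicOpen (ratio i j) ≤ chart j := by
  intro p hp
  have hpi : p ∈ chart i := (ProjZ.{u} n).basicOpen_le _ hp
  rw [Scheme.mem_basicOpen _ _ _ hpi] at hp
  have hp' : IsUnit ((ProjectiveSpectrum.Proj.structureSheaf
    (homogeneousSubmodule (Fin (n + 1)) (ULift.{u} ℤ))).presheaf.germ _ p hpi (ratio i j)) := hp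
  have h := hp'.map (AlgebraicGeometry.Proj.stalkIso' _ p)
  have h2 := AlgebraicGeometry.Proj.stalkIso'_germ
    (homogeneousSubmodule (Fin (n + 1)) (ULift.{u} ℤ)) _ p hpi (ratio i j)
  have h3 : IsUnit ((ratio.{u} i j).1 ⟨p, hpi⟩) := h2 ▸ h
  rw [← HomogeneousLocalization.isUnit_iff_isUnit_val] at h3
  have h4 := Eq.mp (congrArg IsUnit (ratio_val i j ⟨p, hpi⟩)) h3
  rw [Localization.mk_eq_mk'] at h4
  have : p.asHomogeneousIdeal.toIdeal.IsPrime := p.isPrime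
  exact (IsLocalization.AtPrime.isUnit_mk'_iff (Localization.AtPrime p.asHomogeneousIdeal.toIdeal)
    p.asHomogeneousIdeal.toIdeal _ _).1 h4

/-- The coordinate functions generate the ring of functions on a standard chart. -/
theorem eval₂Hom_ratio_surjective (i : Fin (n + 1))
    (c : ULift.{u} ℤ →+* Γ(ProjZ.{u} n, chart i)) :
    Function.Surjective (eval₂Hom c (ratio i)) := by
  let S := MvPolynomial (Fin (n + 1)) (ULift.{u} ℤ)
  let 𝒜 := homogeneousSubmodule (Fin (n + 1)) (ULift.{u} ℤ)
  have huniq {T : Type u} [CommRing T] (a b : ULift.{u} ℤ →+* T) : a = b := by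
    have : a.comp ULift.ringEquiv.symm.toRingHom = b.comp ULift.ringEquiv.symm.toRingHom :=
      Subsingleton.elim _ _
    ext x
    exact RingHom.congr_fun this x.down
  let Λ := Localization.Away (X i : S)
  let α : HomogeneousLocalization.Away 𝒜 (X i) →+* Λ := algebraMap _ _
  have hα (x) : α x = x.val := rfl
  let c' : ULift.{u} ℤ →+* HomogeneousLocalization.Away 𝒜 (X i) :=
    (Int.castRingHom (HomogeneousLocalization.Away 𝒜 (X i))).comp
      (ULift.ringEquiv : ULift.{u} ℤ ≃+* ℤ).toRingHom
  let y (j : Fin (n + 1)) : HomogeneousLocalization.Away 𝒜 (X i) :=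
    HomogeneousLocalization.Away.mk _ (d := 1) (X_mem_homogeneousSubmodule _ i) 1
      (X j) ((one_smul ℕ 1).symm ▸ X_mem_homogeneousSubmodule _ j)
  let v : Λ := Localization.mk 1 ⟨X i, Submonoid.mem_powers _⟩
  have hy (j) : α (y j) = v * algebraMap S Λ (X j) := by
    rw [hα, HomogeneousLocalization.Away.val_mk, ← Localization.mk_one_eq_algebraMap,
      Localization.mk_mul]
    simp
  have hsurj : Function.Surjective (eval₂Hom c' y) := by
    intro x
    obtain ⟨e, F, hF, rfl⟩ :=
      HomogeneousLocalization.Away.mk_surjective 𝒜 (X_mem_homogeneousSubmodule _ i) x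
    refine ⟨F, HomogeneousLocalization.val_injective _ ?_⟩
    rw [← hα, ← hα]
    rw [smul_eq_mul, mul_one] at hF
    have h1 : α (eval₂Hom c' y F) = eval₂ (α.comp c') (fun j => v * algebraMap S Λ (X j)) F := by
      rw [← funext hy]
      exact MvPolynomial.hom_eval₂ F c' α y
    have h2 : eval₂ ((algebraMap S Λ).comp C) (fun j => algebraMap S Λ (X j)) F =
        algebraMap S Λ F := by
      refine (MvPolynomial.hom_eval₂ F C (algebraMap S Λ) X).symm.trans ?_
      rw [eval₂_eta]
    rw [h1, IsHomogeneous.eval₂_mul hF, huniq (α.comp c') ((algebraMap S Λ).comp C), h2, hα,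
      HomogeneousLocalization.Away.val_mk, Localization.mk_pow, ← Localization.mk_one_eq_algebraMap,
      Localization.mk_mul]
    simp
  let β := (Proj.awayToSection 𝒜 (X i)).hom
  have hβ : Function.Surjective β :=
    (ConcreteCategory.bijective_of_isIso (Proj.basicOpenIsoAway 𝒜 (X i)
      (X_mem_homogeneousSubmodule _ i) one_pos).hom).2
  have : eval₂Hom c (ratio i) = β.comp (eval₂Hom c' y) := by
    apply MvPolynomial.ringHom_ext
    · intro r
      refine (eval₂Hom_C c _ r).trans ((RingHom.congr_fun (huniq c (β.comp c')) r).trans ?_)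
      exact congrArg β (eval₂Hom_C c' y r).symm
    · intro j
      exact (eval₂Hom_X' c _ j).trans (congrArg β (eval₂Hom_X' c' y j).symm)
  rw [this]
  exact hβ.comp hsurj

end ProjSpace

end Ratio

/-! ### Dehomogenization of polynomials -/

section Dehomogenization

open MvPolynomial

namespace AlgebraicGeometry

variable {R : Type u} [CommRing R] {Z : Scheme.{u}}

/-- The ring homomorphism from `R` to the functions on an open subset of a scheme over `R`. -/
noncomputable def specToSections (h : Z ⟶ Spec (.of R)) (U : Z.Opens) : R →+* Γ(Z, U) :=
  ((Scheme.ΓSpecIso (.of R)).inv ≫ h.appTop ≫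
    Z.presheaf.map (homOfLE le_top : U ⟶ ⊤).op).hom

theorem appLE_comp_specToSections (h : Z ⟶ Spec (.of R)) {W : Scheme.{u}} (g : W ⟶ Z)
    (U : Z.Opens) (U' : W.Opens) (hU : U' ≤ g ⁻¹ᵁ U) :
    (g.appLE U U' hU).hom.comp (specToSections h U) = specToSections (g ≫ h) U' := by
  rw [specToSections, specToSections, ← CommRingCat.hom_comp]
  congr 1
  simp only [Category.assoc, Scheme.Hom.map_appLE, Scheme.Hom.comp_appTop]
  rfl

theorem map_comp_specToSections (h : Z ⟶ Spec (.of R)) {U U' : Z.Opens} (hU : U' ≤ U) :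
    (Z.presheaf.map (homOfLE hU).op).hom.comp (specToSections h U) = specToSections h U' := by
  rw [specToSections, specToSections, ← CommRingCat.hom_comp]
  congr 1
  simp only [Category.assoc, ← Functor.map_comp]
  rfl

theorem specToSections_comp_specMap {A : Type u} [CommRing A] (φ : A →+* R)
    (h : Z ⟶ Spec (.of R)) (U : Z.Opens) :
    specToSections (h ≫ Spec.map (CommRingCat.ofHom φ)) U = (specToSections h U).comp φ := by
  have : φ = (CommRingCat.ofHom φ).hom := rfl
  rw [specToSections, specToSections, this, ← CommRingCat.hom_comp]
  congr 1
  rw [Scheme.Hom.comp_appTop, Scheme.ΓSpecIso_inv_naturality_assoc, Category.assoc]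

end AlgebraicGeometry

namespace ProjSpace

variable {n : ℕ} {R : Type u} [CommRing R] {Z : Scheme.{u}}

/-- Evaluation of polynomials over `R` at the functions `x₀ / xᵢ, …, xₙ / xᵢ` on an open subset `U`
of a scheme `Z` over `ℙⁿ_R` which lies over the `i`-th standard chart. -/
noncomputable def chartHom (f : Z ⟶ ProjSpace n (Spec (.of R))) (i : Fin (n + 1)) (U : Z.Opens)
    (hU : U ≤ (f ≫ toProjZ n _) ⁻¹ᵁ chart i) : MvPolynomial (Fin (n + 1)) R →+* Γ(Z, U) :=
  eval₂Hom (specToSections (f ≫ toBase n _) U)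
    (fun j => ((f ≫ toProjZ n _).appLE (chart i) U hU).hom (ratio i j))

variable (f : Z ⟶ ProjSpace n (Spec (.of R))) (i : Fin (n + 1)) (U : Z.Opens)
  (hU : U ≤ (f ≫ toProjZ n _) ⁻¹ᵁ chart i)

theorem chartHom_C (r : R) :
    chartHom f i U hU (C r) = specToSections (f ≫ toBase n _) U r :=
  eval₂Hom_C _ _ _

theorem chartHom_X (j : Fin (n + 1)) : chartHom f i U hU (X j) =
    ((f ≫ toProjZ n _).appLE (chart i) U hU).hom (ratio i j) :=
  eval₂Hom_X' _ _ _

theorem chartHom_X_self : chartHom f i U hU (X i) = 1 := by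
  rw [chartHom_X, ratio_self, map_one]

theorem chartOn_le {k : Type u} [Field k] (f : Z ⟶ ProjSpace n (Spec (.of k)))
    (i : Fin (n + 1)) : chartOn f i ≤ (f ≫ toProjZ n _) ⁻¹ᵁ chart i := le_rfl

theorem dehomogenize_eq_chartHom {k : Type u} [Field k] (f : Z ⟶ ProjSpace n (Spec (.of k)))
    (i : Fin (n + 1)) : dehomogenize f i = chartHom f i (chartOn f i) (chartOn_le f i) := by
  apply MvPolynomial.ringHom_ext
  · intro r
    rw [chartHom_C]
    exact eval₂Hom_C _ _ _
  · intro j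
    rw [chartHom_X]
    refine (eval₂Hom_X' _ _ _).trans ?_
    exact congrArg (fun φ => (CommRingCat.Hom.hom φ) (ratio.{u} i j))
      (Scheme.Hom.appLE_eq_app (f ≫ toProjZ n _) (U := chart i)).symm

theorem appLE_comp_chartHom {W : Scheme.{u}} (g : W ⟶ Z) (U' : W.Opens) (h : U' ≤ g ⁻¹ᵁ U)
    (h' : U' ≤ ((g ≫ f) ≫ toProjZ n _) ⁻¹ᵁ chart i) :
    (g.appLE U U' h).hom.comp (chartHom f i U hU) = chartHom (g ≫ f) i U' h' := by
  apply MvPolynomial.ringHom_ext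
  · intro r
    rw [RingHom.comp_apply, chartHom_C, chartHom_C, ← RingHom.comp_apply,
      appLE_comp_specToSections, Category.assoc]
  · intro j
    rw [RingHom.comp_apply, chartHom_X, chartHom_X, ← RingHom.comp_apply, ← CommRingCat.hom_comp]
    simp only [Category.assoc, Scheme.Hom.appLE_comp_appLE]

theorem map_comp_chartHom (U' : Z.Opens) (h : U' ≤ U) :
    (Z.presheaf.map (homOfLE h).op).hom.comp (chartHom f i U hU) =
      chartHom f i U' (h.trans hU) := by
  apply MvPolynomial.ringHom_ext
  · intro r
    rw [RingHom.comp_apply, chartHom_C, chartHom_C, ← RingHom.comp_apply,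
      map_comp_specToSections]
  · intro j
    rw [RingHom.comp_apply, chartHom_X, chartHom_X, ← RingHom.comp_apply, ← CommRingCat.hom_comp,
      Scheme.Hom.appLE_map]

theorem map_toBase {S T : Scheme.{u}} (s : T ⟶ S) :
    map n s ≫ toBase n S = toBase n T ≫ s := pullback.lift_fst _ _ _

theorem map_toProjZ {S T : Scheme.{u}} (s : T ⟶ S) :
    map n s ≫ toProjZ n S = toProjZ n T := pullback.lift_snd _ _ _

theorem chartHom_comp_map {A : Type u} [CommRing A] (φ : A →+* R)
    (hU' : U ≤ ((f ≫ map n (Spec.map (CommRingCat.ofHom φ))) ≫ toProjZ n _) ⁻¹ᵁ chart i) :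
    chartHom (f ≫ map n (Spec.map (CommRingCat.ofHom φ))) i U hU' =
      (chartHom f i U hU).comp (MvPolynomial.map φ) := by
  apply MvPolynomial.ringHom_ext
  · intro r
    rw [RingHom.comp_apply, map_C, chartHom_C, chartHom_C, Category.assoc, map_toBase,
      ← Category.assoc, specToSections_comp_specMap, RingHom.comp_apply]
  · intro j
    rw [RingHom.comp_apply, map_X, chartHom_X, chartHom_X]
    simp only [Category.assoc, map_toProjZ]

/-- The change of charts. -/
theorem chartHom_eq_pow_mul (j : Fin (n + 1)) (hj : U ≤ (f ≫ toProjZ n _) ⁻¹ᵁ chart j)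
    {F : MvPolynomial (Fin (n + 1)) R} {e : ℕ} (hF : F.IsHomogeneous e) :
    chartHom f i U hU F = chartHom f i U hU (X j) ^ e * chartHom f j U hj F := by
  refine Eq.trans ?_ (hF.eval₂_mul _ _ _)
  rw [chartHom_X]
  refine (congrFun (coe_eval₂Hom _ _) F).trans ?_
  congr 1
  funext l
  have key (V : (ProjZ.{u} n).Opens) (hV : chart i ⊓ chart j ≤ V) (x) :
      ((f ≫ toProjZ n _).appLE (chart i ⊓ chart j) U (le_inf hU hj)).hom
        ((ProjZ.{u} n).presheaf.map (homOfLE hV).op x) =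
      ((f ≫ toProjZ n _).appLE V U ((le_inf hU hj).trans
        ((f ≫ toProjZ n _).preimage_mono hV))).hom x :=
    congrArg (fun φ => CommRingCat.Hom.hom φ x)
      (Scheme.Hom.map_appLE (f ≫ toProjZ n _) (le_inf hU hj) (homOfLE hV).op)
  have h := congrArg ((f ≫ toProjZ n _).appLE (chart i ⊓ chart j) U (le_inf hU hj)).hom
    (ratio_mul_ratio.{u} i j l)
  rw [map_mul, key, key, key] at h
  exact h

end ProjSpace

end Dehomogenization

/-! ### The standard affine cover of projective space -/

section StandardCover

open MvPolynomial

theorem CommRingCat.subring_eq_top_of_isPushout {A B C P : CommRingCat.{u}} {f : A ⟶ B} {g : A ⟶ C}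
    {inl : B ⟶ P} {inr : C ⟶ P} (h : IsPushout f g inl inr) (S : Subring P)
    (hl : ∀ b, inl.hom b ∈ S) (hr : ∀ c, inr.hom c ∈ S) : S = ⊤ := by
  let l : B ⟶ .of S := CommRingCat.ofHom (inl.hom.codRestrict S hl)
  let r : C ⟶ .of S := CommRingCat.ofHom (inr.hom.codRestrict S hr)
  let ι : .of S ⟶ P := CommRingCat.ofHom S.subtype
  have hlι : l ≫ ι = inl := rfl
  have hrι : r ≫ ι = inr := rfl
  have : Mono ι := ConcreteCategory.mono_of_injective _ Subtype.val_injective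
  have hw : f ≫ l = g ≫ r := by
    rw [← cancel_mono ι, Category.assoc, Category.assoc, hlι, hrι, h.w]
  have hd : h.desc l r hw ≫ ι = 𝟙 P := by
    apply h.hom_ext
    · rw [IsPushout.inl_desc_assoc, hlι, Category.comp_id]
    · rw [IsPushout.inr_desc_assoc, hrι, Category.comp_id]
  rw [eq_top_iff]
  intro x _
  have hx : ι.hom ((h.desc l r hw).hom x) = x := congrArg (fun φ => CommRingCat.Hom.hom φ x) hd
  rw [← hx]
  exact ((h.desc l r hw).hom x).2

namespace ProjSpace

variable {n : ℕ}

theorem isAffineOpen_chart (i : Fin (n + 1)) : IsAffineOpen (chart.{u} i) :=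
  Proj.isAffineOpen_basicOpen _ _ (X_mem_homogeneousSubmodule _ i) one_pos

theorem iSup_chart : ⨆ i, chart.{u} (n := n) i = ⊤ := by
  refine Proj.iSup_basicOpen_eq_top' _ (fun i => X i)
    (fun i => ⟨1, X_mem_homogeneousSubmodule _ i⟩) ?_
  rw [← top_le_iff]
  intro p _
  have hp : p ∈ Algebra.adjoin (ULift.{u} ℤ) (Set.range (X : Fin (n + 1) → _)) := by
    rw [adjoin_range_X]; trivial
  induction hp using Algebra.adjoin_induction with
  | mem x hx => exact Algebra.subset_adjoin hx
  | algebraMap r =>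
    refine Subalgebra.algebraMap_mem (Algebra.adjoin _ _)
      (⟨C r, isHomogeneous_C _ r⟩ : homogeneousSubmodule (Fin (n + 1)) (ULift.{u} ℤ) 0)
  | add x y _ _ hx hy => exact add_mem (hx trivial) (hy trivial)
  | mul x y _ _ hx hy => exact mul_mem (hx trivial) (hy trivial)

/-- The open subscheme `xᵢ ≠ 0` of `ℙⁿ_S`. -/
noncomputable def standardOpen (S : Scheme.{u}) (i : Fin (n + 1)) : (ProjSpace n S).Opens :=
  toProjZ n S ⁻¹ᵁ chart i

theorem iSup_standardOpen (S : Scheme.{u}) : ⨆ i, standardOpen (n := n) S i = ⊤ := by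
  have h := congrArg (fun U => toProjZ n S ⁻¹ᵁ U) (iSup_chart.{u} (n := n))
  exact ((toProjZ n S).preimage_iSup _).symm.trans h

theorem isPullback_toBase_toProjZ (S : Scheme.{u}) : IsPullback (toBase n S) (toProjZ n S)
    (terminal.from S) (terminal.from (ProjZ.{u} n)) :=
  IsPullback.of_hasPullback _ _

instance (S : Scheme.{u}) [IsAffine S] : IsAffineHom (toProjZ n S) :=
  MorphismProperty.of_isPullback (P := @IsAffineHom) (isPullback_toBase_toProjZ S) inferInstance

theorem isAffineOpen_standardOpen (S : Scheme.{u}) [IsAffine S] (i : Fin (n + 1)) :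
    IsAffineOpen (standardOpen S i) :=
  (isAffineOpen_chart i).preimage _

instance (S : Scheme.{u}) [IsAffine S] : Scheme.IsSeparated (ProjSpace n S) := by
  refine ⟨?_⟩
  rw [← terminal.comp_from (toProjZ n S)]
  infer_instance

instance (S T : Scheme.{u}) [IsAffine S] [IsAffine T] (s : T ⟶ S) : IsAffineHom (map n s) := by
  have : IsAffineHom (map n s ≫ toProjZ n S) := by rw [map_toProjZ]; infer_instance
  exact IsAffineHom.of_comp _ (toProjZ n S)

variable {R : Type u} [CommRing R]

theorem standardOpen_le (i : Fin (n + 1)) : standardOpen (Spec (.of R)) i ≤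
    (𝟙 (ProjSpace n (Spec (.of R))) ≫ toProjZ n _) ⁻¹ᵁ chart i := by
  rw [Category.id_comp]; exact le_rfl

/-- The ring homomorphism `R[x₀, …, xₙ] → Γ(ℙⁿ_R, xᵢ ≠ 0)` which sends `xⱼ` to `xⱼ / xᵢ`. -/
noncomputable def standardHom (n : ℕ) (R : Type u) [CommRing R] (i : Fin (n + 1)) :
    MvPolynomial (Fin (n + 1)) R →+* Γ(ProjSpace n (Spec (.of R)), standardOpen _ i) :=
  chartHom (𝟙 _) i (standardOpen _ i) (standardOpen_le i)

theorem standardHom_surjective (i : Fin (n + 1)) : Function.Surjective (standardHom n R i) := by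
  have hU : standardOpen (n := n) (Spec (.of R)) i =
      toBase n _ ⁻¹ᵁ ⊤ ⊓ toProjZ n _ ⁻¹ᵁ chart i := by
    rw [Scheme.Hom.preimage_top, top_inf_eq]; rfl
  have := (isIso_pushoutSection_iff (isPullback_toBase_toProjZ (Spec (.of R))).flip
    (US := ⊤) (UT := ⊤) (UX := chart i) (UY := standardOpen _ i) le_top le_top
    (by rw [hU, inf_comm])).1 (isIso_pushoutSection_of_isAffineOpen _ _ _ _
      (isAffineOpen_top _) (isAffineOpen_top _) (isAffineOpen_chart i))
  rw [← RingHom.range_eq_top]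
  refine CommRingCat.subring_eq_top_of_isPushout this _ (fun b => ?_) (fun c => ?_)
  · let c : ULift.{u} ℤ →+* Γ(ProjZ.{u} n, chart i) :=
      (Int.castRingHom _).comp (ULift.ringEquiv : ULift.{u} ℤ ≃+* ℤ).toRingHom
    obtain ⟨p, rfl⟩ := eval₂Hom_ratio_surjective i c b
    induction p using MvPolynomial.induction_on with
    | C r =>
      rw [eval₂Hom_C]
      change _ ∈ _
      have : c r = ((r.down : ℤ) : Γ(ProjZ.{u} n, chart i)) := rfl
      rw [this, map_intCast]
      exact intCast_mem _ _
    | add p q hp hq => rw [map_add, map_add]; exact add_mem hp hq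
    | mul_X p j hp =>
      rw [map_mul, map_mul]
      refine mul_mem hp ⟨X j, ?_⟩
      rw [eval₂Hom_X', standardHom, chartHom_X]
      simp only [Category.id_comp]
  · obtain ⟨r, rfl⟩ := (ConcreteCategory.bijective_of_isIso
      (Scheme.ΓSpecIso (.of R)).inv).2 c
    refine ⟨C r, ?_⟩
    rw [standardHom, chartHom_C, specToSections, Category.id_comp]
    rfl

end ProjSpace

end StandardCover

/-! ### The closed subscheme defined by homogeneous polynomials -/

section HomogeneousEquations

open MvPolynomial

namespace ProjSpace

variable {n : ℕ} {R : Type u} [CommRing R]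

instance (i : Fin (n + 1)) : IsAffineHom (standardOpen (Spec (.of R)) i).ι := by
  have : IsAffine (standardOpen (n := n) (Spec (.of R)) i) := isAffineOpen_standardOpen _ i
  have : IsAffineHom ((standardOpen (Spec (.of R)) i).ι ≫
    terminal.from (ProjSpace n (Spec (.of R)))) := inferInstance
  exact IsAffineHom.of_comp _ (terminal.from _)

theorem le_preimage_chart (i : Fin (n + 1))
    (U : (standardOpen (n := n) (Spec (.of R)) i).toScheme.Opens) :
    U ≤ ((standardOpen (Spec (.of R)) i).ι ≫ toProjZ n _) ⁻¹ᵁ chart i := by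
  intro x _
  exact x.2

/-- Dehomogenization with respect to `xᵢ`, with values in the functions on an open subset of the
open subscheme `xᵢ ≠ 0` of `ℙⁿ_R`. -/
noncomputable def localHom (i : Fin (n + 1))
    (U : (standardOpen (n := n) (Spec (.of R)) i).toScheme.Opens) :
    MvPolynomial (Fin (n + 1)) R →+* Γ(standardOpen (n := n) (Spec (.of R)) i, U) :=
  chartHom (standardOpen (Spec (.of R)) i).ι i U (le_preimage_chart i U)

theorem ι_app_comp_standardHom (i j : Fin (n + 1)) (p : MvPolynomial (Fin (n + 1)) R)
    (h : (standardOpen (Spec (.of R)) i).ι ⁻¹ᵁ standardOpen _ j ≤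
      ((standardOpen (Spec (.of R)) i).ι ≫ toProjZ n _) ⁻¹ᵁ chart j) :
    ((standardOpen (Spec (.of R)) i).ι.app (standardOpen _ j)).hom (standardHom n R j p) =
      chartHom (standardOpen (Spec (.of R)) i).ι j _ h p := by
  have := appLE_comp_chartHom (𝟙 _) j (standardOpen _ j) (standardOpen_le j)
    (standardOpen (Spec (.of R)) i).ι ((standardOpen (Spec (.of R)) i).ι ⁻¹ᵁ standardOpen _ j)
    le_rfl h
  rw [Scheme.Hom.appLE_eq_app] at this
  refine (RingHom.congr_fun this p).trans ?_
  simp only [Category.comp_id]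

theorem ofIdealTop_ideal_span {τ : Type*} (F : τ → MvPolynomial (Fin (n + 1)) R)
    (i : Fin (n + 1)) (U : (standardOpen (n := n) (Spec (.of R)) i).toScheme.affineOpens) :
    (Scheme.IdealSheafData.ofIdealTop
      (Ideal.span (Set.range fun t => localHom i ⊤ (F t)))).ideal U =
      Ideal.span (Set.range fun t => localHom i U.1 (F t)) := by
  rw [Scheme.IdealSheafData.ofIdealTop_ideal, Ideal.map_span, ← Set.range_comp]
  congr 2
  funext t
  exact RingHom.congr_fun (map_comp_chartHom _ i ⊤ _ U.1 le_top) (F t)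

/-- Homogeneous polynomials define an ideal sheaf on projective space. It is obtained as the
intersection of the ideal sheaves of the closures of the closed subschemes of the standard opens
which the dehomogenized polynomials define. -/
theorem exists_idealSheafData {τ : Type*} (F : τ → MvPolynomial (Fin (n + 1)) R)
    (hF : ∀ t, ∃ e, (F t).IsHomogeneous e) :
    ∃ I : (ProjSpace n (Spec (.of R))).IdealSheafData, ∀ i,
      I.ideal ⟨standardOpen _ i, isAffineOpen_standardOpen _ i⟩ =
        Ideal.span (Set.range fun t => standardHom n R i (F t)) := by
  refine ⟨⨅ i, (Scheme.IdealSheafData.ofIdealTop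
    (Ideal.span (Set.range fun t => localHom i ⊤ (F t)))).map
      (standardOpen (Spec (.of R)) i).ι, fun j => ?_⟩
  rw [Scheme.IdealSheafData.ideal_iInf, iInf_apply]
  simp only [Scheme.IdealSheafData.ideal_map_of_isAffineHom, ofIdealTop_ideal_span]
  apply le_antisymm
  · refine (iInf_le _ j).trans ?_
    have := Scheme.Hom.isIso_app (standardOpen (n := n) (Spec (.of R)) j).ι (standardOpen _ j)
      (Scheme.Opens.opensRange_ι _).ge
    have hb := ConcreteCategory.bijective_of_isIso
      ((standardOpen (n := n) (Spec (.of R)) j).ι.app (standardOpen _ j))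
    have hspan : Ideal.span (Set.range fun t => localHom j
        ((standardOpen (Spec (.of R)) j).ι ⁻¹ᵁ standardOpen _ j) (F t)) =
        (Ideal.span (Set.range fun t => standardHom n R j (F t))).map
          ((standardOpen (n := n) (Spec (.of R)) j).ι.app (standardOpen _ j)).hom := by
      rw [Ideal.map_span, ← Set.range_comp]
      congr 2
      funext t
      exact (ι_app_comp_standardHom j j (F t) _).symm
    rw [hspan]
    exact (Ideal.comap_map_of_bijective _ hb).le
  · refine le_iInf fun i => Ideal.span_le.2 ?_
    rintro _ ⟨t, rfl⟩
    obtain ⟨e, he⟩ := hF t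
    have hi := le_preimage_chart i ((standardOpen (Spec (.of R)) i).ι ⁻¹ᵁ standardOpen _ j)
    have hj : (standardOpen (Spec (.of R)) i).ι ⁻¹ᵁ standardOpen _ j ≤
      ((standardOpen (Spec (.of R)) i).ι ≫ toProjZ n _) ⁻¹ᵁ chart j := le_rfl
    change ((standardOpen (Spec (.of R)) i).ι.app (standardOpen _ j)).hom
      (standardHom n R j (F t)) ∈ Ideal.span _
    rw [ι_app_comp_standardHom i j (F t) hj, chartHom_eq_pow_mul _ j _ hj i hi he]
    exact Ideal.mul_mem_left _ _ (Ideal.subset_span ⟨t, rfl⟩)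

end ProjSpace

end HomogeneousEquations

/-! ### The homogeneous ideal of a closed subscheme -/

section VanishingIdeal

open MvPolynomial

namespace ProjSpace

variable {n : ℕ} {k : Type u} [Field k] {Z : Scheme.{u}} (f : Z ⟶ ProjSpace n (Spec (.of k)))

theorem dehomogenize_eq_zero_of_mem_vanishingIdeal {p : MvPolynomial (Fin (n + 1)) k}
    (hp : p ∈ (vanishingIdeal f).toIdeal) (i : Fin (n + 1)) : dehomogenize f i p = 0 :=
  (Ideal.mem_iInf.1 (Ideal.toIdeal_homogeneousCore_le _ _ hp)) i

theorem mem_vanishingIdeal_of_forall_dehomogenize_eq_zero {p : MvPolynomial (Fin (n + 1)) k}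
    {e : ℕ} (hp : p.IsHomogeneous e) (h : ∀ i, dehomogenize f i p = 0) :
    p ∈ (vanishingIdeal f).toIdeal :=
  Ideal.mem_homogeneousCore_of_homogeneous_of_mem ⟨e, hp⟩ (Ideal.mem_iInf.2 h)

theorem dehomogenize_X_self (i : Fin (n + 1)) : dehomogenize f i (X i) = 1 := by
  rw [dehomogenize_eq_chartHom, chartHom_X_self]

/-- If a form vanishes on the chart `xⱼ ≠ 0`, then it vanishes on the part of any other chart which
lies over `xⱼ ≠ 0`. -/
theorem map_dehomogenize_eq_zero {p : MvPolynomial (Fin (n + 1)) k} {e : ℕ}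
    (hp : p.IsHomogeneous e) {i j : Fin (n + 1)} (h : dehomogenize f j p = 0) {U : Z.Opens}
    (hi : U ≤ chartOn f i) (hj : U ≤ chartOn f j) :
    Z.presheaf.map (homOfLE hi).op (dehomogenize f i p) = 0 := by
  rw [dehomogenize_eq_chartHom] at h ⊢
  have h1 := RingHom.congr_fun (map_comp_chartHom f i _ (chartOn_le f i) U hi) p
  have h2 := RingHom.congr_fun (map_comp_chartHom f j _ (chartOn_le f j) U hj) p
  rw [RingHom.comp_apply, h, map_zero] at h2
  refine h1.trans ?_
  rw [chartHom_eq_pow_mul f i U _ j (hj.trans (chartOn_le f j)) hp, ← h2, mul_zero]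

theorem basicOpen_dehomogenize_X_le (i j : Fin (n + 1)) :
    Z.basicOpen (dehomogenize f i (X j)) ≤ chartOn f j := by
  have h : dehomogenize f i (X j) = ((f ≫ toProjZ n _).app (chart i)).hom (ratio i j) :=
    eval₂Hom_X' _ _ _
  rw [h]
  exact ((f ≫ toProjZ n _).preimage_basicOpen (ratio i j)).ge.trans
    ((f ≫ toProjZ n _).preimage_mono (basicOpen_ratio_le i j))

/-- A form which vanishes on the chart `xⱼ ≠ 0` of a reduced scheme vanishes everywhere once it is
multiplied by `xⱼ`. -/
theorem X_mul_mem_vanishingIdeal [IsReduced Z] {p : MvPolynomial (Fin (n + 1)) k} {e : ℕ}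
    (hp : p.IsHomogeneous e) {j : Fin (n + 1)} (h : dehomogenize f j p = 0) :
    X j * p ∈ (vanishingIdeal f).toIdeal := by
  refine mem_vanishingIdeal_of_forall_dehomogenize_eq_zero f ((isHomogeneous_X _ j).mul hp)
    fun i => ?_
  rw [map_mul, ← basicOpen_eq_bot_iff, Scheme.basicOpen_mul]
  have hi : Z.basicOpen (dehomogenize f i (X j)) ≤ chartOn f i := Z.basicOpen_le _
  have h0 := map_dehomogenize_eq_zero f hp h hi (basicOpen_dehomogenize_X_le f i j)
  have h1 := Z.basicOpen_res (dehomogenize f i p) (homOfLE hi).op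
  rw [h0, Scheme.basicOpen_zero] at h1
  exact h1.symm

/-- Over an integral scheme, a form which vanishes on a nonempty chart vanishes everywhere. -/
theorem mem_vanishingIdeal_of_dehomogenize_eq_zero [IsIntegral Z]
    {p : MvPolynomial (Fin (n + 1)) k} {e : ℕ} (hp : p.IsHomogeneous e) {j : Fin (n + 1)}
    (hj : (chartOn f j : Set Z).Nonempty) (h : dehomogenize f j p = 0) :
    p ∈ (vanishingIdeal f).toIdeal := by
  refine mem_vanishingIdeal_of_forall_dehomogenize_eq_zero f hp fun i => ?_
  by_cases hi : (chartOn f i : Set Z).Nonempty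
  · obtain ⟨x, hx⟩ := nonempty_preirreducible_inter (chartOn f i).2 (chartOn f j).2 hi hj
    have : Nonempty ↥(chartOn f i ⊓ chartOn f j) := ⟨⟨x, hx⟩⟩
    apply map_injective_of_isIntegral Z (H := this)
      (homOfLE (inf_le_left : chartOn f i ⊓ chartOn f j ≤ _))
    rw [map_dehomogenize_eq_zero f hp h inf_le_left inf_le_right, map_zero]
  · rw [TopologicalSpace.Opens.not_nonempty_iff_eq_bot] at hi
    rw [← basicOpen_eq_bot_iff, ← le_bot_iff, ← hi]
    exact Z.basicOpen_le _

theorem iSup_chartOn : ⨆ i, chartOn f i = ⊤ := by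
  have h := congrArg (fun U => (f ≫ toProjZ n _) ⁻¹ᵁ U) (iSup_chart.{u} (n := n))
  exact ((f ≫ toProjZ n _).preimage_iSup _).symm.trans h

theorem exists_nonempty_chartOn [Nonempty Z] : ∃ i, (chartOn f i : Set Z).Nonempty := by
  obtain ⟨x⟩ := ‹Nonempty Z›
  have hx : x ∈ ⨆ i, chartOn f i := by rw [iSup_chartOn]; trivial
  obtain ⟨i, hi⟩ := TopologicalSpace.Opens.mem_iSup.1 hx
  exact ⟨i, x, hi⟩

theorem X_notMem_vanishingIdeal {i : Fin (n + 1)} (hi : (chartOn f i : Set Z).Nonempty) :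
    X i ∉ (vanishingIdeal f).toIdeal := by
  intro h
  have h0 := dehomogenize_eq_zero_of_mem_vanishingIdeal f h i
  rw [dehomogenize_X_self] at h0
  have : Nonempty ↥(chartOn f i) := hi.to_subtype
  exact one_ne_zero h0

theorem vanishingIdeal_isPrime [IsIntegral Z] : (vanishingIdeal f).toIdeal.IsPrime := by
  obtain ⟨j, hj⟩ := exists_nonempty_chartOn f
  refine Ideal.IsHomogeneous.isPrime_of_homogeneous_mem_or_mem (vanishingIdeal f).isHomogeneous
    (fun h => X_notMem_vanishingIdeal f hj (h ▸ Submodule.mem_top)) ?_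
  rintro x y ⟨a, hx⟩ ⟨b, hy⟩ hxy
  have h := dehomogenize_eq_zero_of_mem_vanishingIdeal f hxy j
  have : Nonempty ↥(chartOn f j) := hj.to_subtype
  have : IsDomain Γ(Z, chartOn f j) :=
    @IsIntegral.component_integral Z _ (chartOn f j) this
  rw [map_mul, mul_eq_zero] at h
  exact h.imp (mem_vanishingIdeal_of_dehomogenize_eq_zero f hx hj)
    (mem_vanishingIdeal_of_dehomogenize_eq_zero f hy hj)

theorem app_standardHom (i : Fin (n + 1)) (p : MvPolynomial (Fin (n + 1)) k) :
    (f.app (standardOpen _ i)).hom (standardHom n k i p) = dehomogenize f i p := by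
  have h := appLE_comp_chartHom (𝟙 _) i (standardOpen _ i) (standardOpen_le i) f
    (f ⁻¹ᵁ standardOpen _ i) le_rfl (by rw [Category.comp_id]; exact chartOn_le f i)
  rw [Scheme.Hom.appLE_eq_app] at h
  rw [dehomogenize_eq_chartHom]
  refine (RingHom.congr_fun h p).trans ?_
  simp only [Category.comp_id]
  rfl

/-- A reduced closed subscheme of projective space is cut out by its homogeneous ideal. -/
theorem ker_app_eq_map_vanishingIdeal [IsReduced Z] (i : Fin (n + 1)) :
    RingHom.ker (f.app (standardOpen _ i)).hom =
      (vanishingIdeal f).toIdeal.map (standardHom n k i) := by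
  apply le_antisymm
  · intro a ha
    obtain ⟨p, rfl⟩ := standardHom_surjective i a
    -- the homogenization of `p` with respect to `xᵢ`
    let q : MvPolynomial (Fin (n + 1)) k := ∑ e ∈ Finset.range (p.totalDegree + 1),
      X i ^ (p.totalDegree - e) * homogeneousComponent e p
    have hq : q.IsHomogeneous p.totalDegree := by
      refine IsHomogeneous.sum _ _ _ fun e he => ?_
      have h := ((isHomogeneous_X k i).pow (p.totalDegree - e)).mul
        (homogeneousComponent_isHomogeneous e p)
      rwa [one_mul, Nat.sub_add_cancel (Nat.lt_succ_iff.1 (Finset.mem_range.1 he))] at h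
    have hX : standardHom n k i (X i) = 1 := chartHom_X_self _ _ _ _
    have hpq : standardHom n k i (X i * q) = standardHom n k i p := by
      conv_rhs => rw [← p.sum_homogeneousComponent]
      simp only [q, map_mul, map_sum, map_pow, hX, one_pow, one_mul]
    rw [← hpq]
    refine Ideal.mem_map_of_mem _ (X_mul_mem_vanishingIdeal f hq ?_)
    rw [← app_standardHom, ← one_mul (standardHom n k i q), ← hX, ← map_mul, hpq]
    exact ha
  · refine Ideal.map_le_iff_le_comap.2 fun p hp => ?_
    rw [Ideal.mem_comap, RingHom.mem_ker, app_standardHom]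
    exact dehomogenize_eq_zero_of_mem_vanishingIdeal f hp i

end ProjSpace

end VanishingIdeal

/-! ### Fibres of the universal family -/

section Fibres

open MvPolynomial

namespace ProjSpace

variable {n : ℕ} {A R : Type u} [CommRing A] [CommRing R] (φ : A →+* R)

theorem standardOpen_le_preimage_map (i : Fin (n + 1)) : standardOpen (Spec (.of R)) i ≤
    map n (Spec.map (CommRingCat.ofHom φ)) ⁻¹ᵁ standardOpen _ i := by
  change _ ≤ (map n (Spec.map (CommRingCat.ofHom φ)) ≫ toProjZ n _) ⁻¹ᵁ chart i
  rw [map_toProjZ]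
  exact le_rfl

theorem appLE_map_standardHom (i : Fin (n + 1)) (p : MvPolynomial (Fin (n + 1)) A) :
    ((map n (Spec.map (CommRingCat.ofHom φ))).appLE (standardOpen _ i) (standardOpen _ i)
      (standardOpen_le_preimage_map φ i)).hom (standardHom n A i p) =
        standardHom n R i (MvPolynomial.map φ p) := by
  have hle : standardOpen (Spec (.of R)) i ≤
      (map n (Spec.map (CommRingCat.ofHom φ)) ≫ toProjZ n _) ⁻¹ᵁ chart i :=
    standardOpen_le_preimage_map φ i
  have h1 := appLE_comp_chartHom (𝟙 _) i (standardOpen _ i) (standardOpen_le i)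
    (map n (Spec.map (CommRingCat.ofHom φ))) (standardOpen _ i)
    (standardOpen_le_preimage_map φ i) (by rw [Category.comp_id]; exact hle)
  have h2 := chartHom_comp_map (𝟙 _) i (standardOpen _ i) (standardOpen_le i) φ
    (by rw [Category.id_comp]; exact hle)
  refine (RingHom.congr_fun h1 p).trans (Eq.trans ?_ (RingHom.congr_fun h2 p))
  simp only [Category.comp_id, Category.id_comp]

/-- The pullback along `ℙⁿ_R ⟶ ℙⁿ_A` of the ideal sheaf defined by homogeneous polynomials over `A`
is the ideal sheaf of a closed subscheme `Z` of `ℙⁿ_R` if `Z` is defined by the images of these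
polynomials. -/
theorem comap_eq_ker {τ : Type*} (F : τ → MvPolynomial (Fin (n + 1)) A)
    (I : (ProjSpace n (Spec (.of A))).IdealSheafData)
    (hI : ∀ i, I.ideal ⟨standardOpen _ i, isAffineOpen_standardOpen _ i⟩ =
      Ideal.span (Set.range fun t => standardHom n A i (F t)))
    {Z : Scheme.{u}} (f : Z ⟶ ProjSpace n (Spec (.of R))) [QuasiCompact f]
    (hf : ∀ i, RingHom.ker (f.app (standardOpen _ i)).hom =
      Ideal.span (Set.range fun t => standardHom n R i (MvPolynomial.map φ (F t)))) :
    I.comap (map n (Spec.map (CommRingCat.ofHom φ))) = f.ker := by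
  apply le_antisymm
  · rw [← Scheme.IdealSheafData.le_map_iff_comap_le, ← Scheme.Hom.ker_comp]
    refine Scheme.IdealSheafData.le_of_iSup_eq_top
      (fun i => ⟨standardOpen _ i, isAffineOpen_standardOpen _ i⟩) (iSup_standardOpen _)
      fun i => ?_
    rw [hI, Scheme.Hom.ker_apply, Ideal.span_le]
    rintro _ ⟨t, rfl⟩
    have ht : (f.app (standardOpen _ i)).hom
        (standardHom n R i (MvPolynomial.map φ (F t))) = 0 := by
      rw [← RingHom.mem_ker, hf]
      exact Ideal.subset_span ⟨t, rfl⟩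
    rw [← appLE_map_standardHom, ← Scheme.Hom.appLE_eq_app, ← CommRingCat.comp_apply,
      Scheme.Hom.appLE_comp_appLE] at ht
    have hW : f ⁻¹ᵁ standardOpen _ i =
        (f ≫ map n (Spec.map (CommRingCat.ofHom φ))) ⁻¹ᵁ standardOpen _ i := by
      change _ = f ⁻¹ᵁ ((map n (Spec.map (CommRingCat.ofHom φ)) ≫ toProjZ n _) ⁻¹ᵁ chart i)
      rw [map_toProjZ]
      rfl
    have key (W : Z.Opens)
        (hW : W = (f ≫ map n (Spec.map (CommRingCat.ofHom φ))) ⁻¹ᵁ standardOpen _ i)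
        (h : ((f ≫ map n (Spec.map (CommRingCat.ofHom φ))).appLE _ W hW.le).hom
          (standardHom n A i (F t)) = 0) :
        ((f ≫ map n (Spec.map (CommRingCat.ofHom φ))).app (standardOpen _ i)).hom
          (standardHom n A i (F t)) = 0 := by
      subst hW
      rwa [Scheme.Hom.appLE_eq_app] at h
    exact key _ hW ht
  · refine Scheme.IdealSheafData.le_of_iSup_eq_top
      (fun i => ⟨standardOpen _ i, isAffineOpen_standardOpen _ i⟩) (iSup_standardOpen _)
      fun i => ?_
    rw [Scheme.Hom.ker_apply, hf, Ideal.span_le]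
    rintro _ ⟨t, rfl⟩
    have h1 := Scheme.IdealSheafData.le_map_comap I (map n (Spec.map (CommRingCat.ofHom φ)))
      ⟨standardOpen _ i, isAffineOpen_standardOpen _ i⟩
    rw [hI, Scheme.IdealSheafData.ideal_map_of_isAffineHom] at h1
    have h2 := h1 (Ideal.subset_span ⟨t, rfl⟩)
    have h3 := Scheme.IdealSheafData.ideal_le_comap_ideal
      (I.comap (map n (Spec.map (CommRingCat.ofHom φ))))
      (U := ⟨standardOpen _ i, isAffineOpen_standardOpen _ i⟩)
      (V := ⟨_, (isAffineOpen_standardOpen (n := n) (Spec (.of A)) i).preimage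
        (map n (Spec.map (CommRingCat.ofHom φ)))⟩) (standardOpen_le_preimage_map φ i) h2
    change standardHom n R i (MvPolynomial.map φ (F t)) ∈ _
    rw [← appLE_map_standardHom φ i (F t)]
    exact h3

/-- A closed subscheme of `ℙⁿ_T` whose ideal sheaf is the pullback of `I` is the base change of the
closed subscheme of `ℙⁿ_S` defined by `I`. -/
theorem exists_isPullback {S T : Scheme.{u}} (s : T ⟶ S) (I : (ProjSpace n S).IdealSheafData)
    {Z : Scheme.{u}} (f : Z ⟶ ProjSpace n T) [IsClosedImmersion f]
    (h : I.comap (map n s) = f.ker) :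
    ∃ g : Z ⟶ I.subscheme, IsPullback g f I.subschemeι (map n s) := by
  have hle : I.subschemeι.ker ≤ (f ≫ map n s).ker := by
    rw [Scheme.IdealSheafData.ker_subschemeι, Scheme.Hom.ker_comp,
      Scheme.IdealSheafData.le_map_iff_comap_le]
    exact h.le
  refine ⟨IsClosedImmersion.lift I.subschemeι (f ≫ map n s) hle, ?_⟩
  refine (isPullback_of_isClosedImmersion _ _ _ _ ?_ ?_).flip
  · rw [IsClosedImmersion.lift_fac]
  · rw [Scheme.IdealSheafData.ker_subschemeι, h]

end ProjSpace

end Fibres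

theorem theoremT (n δ : ℕ) :
    IsBoundedCollection.{u} n
      (fun (k : Type u) [Field k] [IsAlgClosed k] (Z : Scheme.{u})
        (f : Z ⟶ ProjSpace n (Spec (.of k))) [IsClosedImmersion f] =>
        AlgebraicGeometry.IsIntegral Z ∧ projDegree f ≤ δ) := by
  obtain ⟨D, hD⟩ := exists_bound_eq_span_totalDegree_le.{u} n δ
  obtain ⟨I, hI⟩ := ProjSpace.exists_idealSheafData (universalForm.{u} n D)
    fun t => ⟨_, universalForm_isHomogeneous n D t⟩
  refine ⟨Spec (.of (UniversalCoeff.{u} n D)),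
    Spec.map (CommRingCat.ofHom (algebraMap (ULift.{u} ℤ) (UniversalCoeff.{u} n D))),
    I.subscheme, I.subschemeι, ?_, inferInstance, inferInstance, ?_⟩
  · rw [HasRingHomProperty.Spec_iff (P := @LocallyOfFiniteType)]
    exact RingHom.finiteType_algebraMap.2 inferInstance
  · rintro k _ _ Z f _ ⟨hZ, hδ⟩
    obtain ⟨i, hi⟩ := ProjSpace.exists_nonempty_chartOn f
    obtain ⟨φ, hφ⟩ := exists_span_universalForm (ProjSpace.vanishingIdeal f) D
    rw [← hD _ (ProjSpace.vanishingIdeal_isPrime f)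
      ⟨i, ProjSpace.X_notMem_vanishingIdeal f hi⟩ hδ] at hφ
    refine ⟨Spec.map (CommRingCat.ofHom φ), ProjSpace.exists_isPullback _ I f
      (ProjSpace.comap_eq_ker φ _ I hI f fun j => ?_)⟩
    rw [ProjSpace.ker_app_eq_map_vanishingIdeal, ← hφ, Ideal.map_span, ← Set.range_comp]
    rfl
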